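/- Let $\lambda>0$ and $\sigma>0$, let $(\tau_i)_{i}$ be the points of a homogeneous Poisson point process of intensity $\lambda$ on $\mathbb{R}$, and let \[ X(t)=\sum_i g_\sigma(t-\tau_i),\qquad g_\sigma(t)=\frac{1}{\sigma\sqrt{2\pi}}\,e^{-t^2/(2\sigma^2)},\qquad t\in\mathbb{R}. \] (Almost surely the series converges for every $t$ and $X$ is twice continuously differentiable on $\mathbb{R}$.) For a process $Y$ and $\alpha\in\mathbb{R}$ put $N_Y(\alpha,[0,1])=\#\{t\in[0,1]: Y(t)=\alpha\}$ and $C_Y(\alpha,[0,1])=\mathbb{E}\,N_Y(\alpha,[0,1])$, and let $\rho(\lambda,\sigma)$ be the expected number of points $t\in[0,1]$ at which $X:\mathbb{R}\to\mathbb{R}$ has a local extremum; these counts are random variables (up to null sets). Then \[ \mathbb{P}\bigl(\exists\, t\in[0,1]:\ X'(t)=0 \text{ and } X''(t)=0\bigr)=0, \] almost surely the local extrema of $X$ in $[0,1]$ are exactly the points of $[0,1]$ where $X'$ vanishes, and hence $\rho(\lambda,\sigma)=\mathbb{E}\,N_{X'}(0,[0,1])$. Moreover, for every $\alpha\in\mathbb{R}$,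 \[ C_X(\alpha,[0,1])\ \le\ \rho(\lambda,\sigma)\ \le\ \bigl(3\lambda(2+2\sigma)+1\bigr)e^{\lambda}. \] -/

import Mathlib

open MeasureTheory ProbabilityTheory Set
open scoped NNReal ENNReal

noncomputable section

namespace ShotNoise

/-- The number of points of the random sequence `τ` lying in `B`, counted with multiplicity. -/
def pointCount {Ω : Type*} (τ : ℕ → Ω → ℝ) (B : Set ℝ) (ω : Ω) : ℕ∞ :=
  Set.encard {i : ℕ | τ i ω ∈ B}

/-- The random variables `τ i` enumerate the points of a homogeneous Poisson point process on the
real line with intensity `lam`: the number of points in a Borel set `B` of finite Lebesgue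
measure is Poisson distributed with parameter `lam * |B|`, and the numbers of points in finitely
many pairwise disjoint Borel sets are independent. -/
structure IsPoissonProcess {Ω : Type*} [MeasurableSpace Ω] (μ : Measure Ω) (lam : ℝ)
    (τ : ℕ → Ω → ℝ) : Prop where
  measurable_point : ∀ i, Measurable (τ i)
  law_count : ∀ B : Set ℝ, MeasurableSet B → volume B ≠ ∞ →
    HasLaw (pointCount τ B)
      ((poissonMeasure (lam * volume.real B).toNNReal).map (fun k : ℕ => (k : ℕ∞))) μ
  indep_count : ∀ (n : ℕ) (B : Fin n → Set ℝ), (∀ j, MeasurableSet (B j)) →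
    Pairwise (fun j k => Disjoint (B j) (B k)) →
    iIndepFun (fun j => pointCount τ (B j)) μ

/-- The Gaussian kernel of width `σ`. -/
def gaussianKernel (σ t : ℝ) : ℝ :=
  1 / (σ * Real.sqrt (2 * Real.pi)) * Real.exp (-t ^ 2 / (2 * σ ^ 2))

/-- The sample path `t ↦ ∑ i, g_σ (t - τ i)` of the shot noise process. -/
def shotNoise {Ω : Type*} (σ : ℝ) (τ : ℕ → Ω → ℝ) (ω : Ω) (t : ℝ) : ℝ :=
  ∑' i, gaussianKernel σ (t - τ i ω)

/-- The multiplicity function `N_f(α, [a, b])`: the number of `t ∈ [a, b]` with `f t = α`. -/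
def crossingCount (f : ℝ → ℝ) (α a b : ℝ) : ℕ∞ :=
  Set.encard {t : ℝ | t ∈ Icc a b ∧ f t = α}

/-- The number of points of `[a, b]` at which `f : ℝ → ℝ` has a local extremum
(relative to the whole line). -/
def localExtrCount (f : ℝ → ℝ) (a b : ℝ) : ℕ∞ :=
  Set.encard {t : ℝ | t ∈ Icc a b ∧ IsLocalExtr f t}

/-- The mean number of crossings `C_Y(α, [a, b])` of the level `α` by the process `Y`. -/
def meanCrossings {Ω : Type*} [MeasurableSpace Ω] (μ : Measure Ω) (Y : Ω → ℝ → ℝ)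
    (α a b : ℝ) : ℝ≥0∞ :=
  ∫⁻ ω, (crossingCount (Y ω) α a b : ℝ≥0∞) ∂μ

/-- The mean number of local extrema of the process `Y` in `[a, b]`. -/
def meanLocalExtr {Ω : Type*} [MeasurableSpace Ω] (μ : Measure Ω) (Y : Ω → ℝ → ℝ)
    (a b : ℝ) : ℝ≥0∞ :=
  ∫⁻ ω, (localExtrCount (Y ω) a b : ℝ≥0∞) ∂μ

end ShotNoise

end

/-! Mecke's formula for the expectation over the configurations with `n + 1` points in a window
removes one of these points and averages over its position `x`. The number of crossings of a level
`c` by `f + g' (· - x)`, integrated over `x`, is at most a sum over the three intervals of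
monotonicity of `g'`, in which each interval `B` contributes the length of the time interval plus
the integral over `u ∈ B` of the number of crossings of the level `c - g' u` by `f`. Uniformly in
the level, this bounds the mean number of crossings by `X'` on the event of `n + 1` points in terms
of that on the event of `n` points. With no point in the window `X'` is strictly increasing, so it
crosses each level at most once, and solving the recursion gives `ρ + 3 ≤ 4 * exp lam`.

Multiple zeros of `X'` are excluded by Mecke's formula as well: for a fixed path, the positions of
an additional point that create a tangency are critical values of differentiable functions, up to
countably many positions at which the kernel has a critical point where the path takes one of the
levels `-g' σ` and `-g' (-σ)`, each of which it takes finitely often.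

Finally, by Rolle's theorem and stationarity, the mean number `C` of crossings by `X` satisfies
`n * C ≤ n * ρ + 1` for all `n`. -/

noncomputable section

namespace ShotNoise

/-! ### Counting and measurability of crossings -/

/-- The index of the dyadic interval `[k / 2 ^ m, (k + 1) / 2 ^ m)` containing `t`. -/
def dyadicIndex (m : ℕ) (t : ℝ) : ℤ := ⌊2 ^ m * t⌋

/-- The dyadic interval `[k / 2 ^ m, (k + 1) / 2 ^ m)`. Counts of points are suprema over `m` of
counts of intervals of order `m`. -/
def dyadicCell (m : ℕ) (k : ℤ) : Set ℝ := dyadicIndex m ⁻¹' {k}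

lemma dyadicCell_eq_Ici_inter_Iio (m : ℕ) (k : ℤ) :
    dyadicCell m k = Ici ((k : ℝ) / 2 ^ m) ∩ Iio (((k : ℝ) + 1) / 2 ^ m) := by
  ext t
  have h : (0 : ℝ) < 2 ^ m := by positivity
  simp only [dyadicCell, dyadicIndex, mem_preimage, mem_singleton_iff, Int.floor_eq_iff,
    mem_inter_iff, mem_Ici, mem_Iio, div_le_iff₀ h, lt_div_iff₀ h, mul_comm t]

lemma ordConnected_dyadicCell (m : ℕ) (k : ℤ) : (dyadicCell m k).OrdConnected := by
  rw [dyadicCell_eq_Ici_inter_Iio]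
  exact ordConnected_Ici.inter ordConnected_Iio

lemma dyadicIndex_succ_div_two (m : ℕ) (t : ℝ) :
    dyadicIndex (m + 1) t / 2 = dyadicIndex m t := by
  unfold dyadicIndex
  rw [← Nat.cast_ofNat (R := ℤ), ← Int.floor_div_natCast]
  congr 1
  push_cast
  ring

lemma encard_image_dyadicIndex_mono (A : Set ℝ) :
    Monotone fun m => (dyadicIndex m '' A).encard := by
  refine monotone_nat_of_le_succ fun m => ?_
  have h : dyadicIndex m '' A = (· / 2) '' (dyadicIndex (m + 1) '' A) := by
    simp only [image_image, dyadicIndex_succ_div_two]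
  rw [h]
  exact encard_image_le _ _

lemma eventually_dyadicIndex_ne {s t : ℝ} (hst : s < t) :
    ∀ᶠ m in Filter.atTop, dyadicIndex m s ≠ dyadicIndex m t := by
  have h : Filter.Tendsto (fun m : ℕ => (2 : ℝ) ^ m * (t - s)) Filter.atTop Filter.atTop :=
    (tendsto_pow_atTop_atTop_of_one_lt one_lt_two).atTop_mul_const (sub_pos.2 hst)
  filter_upwards [h.eventually_ge_atTop 1] with m hm heq
  have h1 := Int.abs_sub_lt_one_of_floor_eq_floor heq.symm
  rw [← mul_sub] at h1
  exact absurd (lt_of_abs_lt h1) (not_lt.2 hm)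

lemma eventually_injOn_dyadicIndex {s : Set ℝ} (hs : s.Finite) :
    ∀ᶠ m in Filter.atTop, InjOn (dyadicIndex m) s := by
  have h : ∀ᶠ m in Filter.atTop, ∀ x ∈ s, ∀ y ∈ s, x < y → dyadicIndex m x ≠ dyadicIndex m y := by
    refine (Filter.eventually_all_finite hs).2 fun x _ => ?_
    refine (Filter.eventually_all_finite hs).2 fun y _ => ?_
    by_cases hxy : x < y
    · exact (eventually_dyadicIndex_ne hxy).mono fun m hm _ => hm
    · exact .of_forall fun _ h => absurd h hxy
  filter_upwards [h] with m hm x hx y hy hxy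
  by_contra hne
  rcases lt_or_gt_of_ne hne with hlt | hlt
  · exact hm x hx y hy hlt hxy
  · exact hm y hy x hx hlt hxy.symm

lemma encard_eq_iSup_encard_image_dyadicIndex (A : Set ℝ) :
    A.encard = ⨆ m, (dyadicIndex m '' A).encard := by
  refine le_antisymm ?_ (iSup_le fun m => encard_image_le _ _)
  refine ENat.forall_natCast_le_iff_le.1 fun n hn => ?_
  obtain ⟨s, hsA, hs⟩ := exists_subset_encard_eq hn
  obtain ⟨m, hm⟩ := (eventually_injOn_dyadicIndex (finite_of_encard_eq_coe hs)).exists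
  calc (n : ℕ∞) = s.encard := hs.symm
    _ = (dyadicIndex m '' s).encard := hm.encard_image.symm
    _ ≤ (dyadicIndex m '' A).encard := encard_le_encard (image_mono hsA)
    _ ≤ _ := le_iSup (fun m => (dyadicIndex m '' A).encard) m

section

variable {X : Type*} (A : X → Set ℝ)

lemma encard_image_dyadicIndex_eq_tsum (m : ℕ) (x : X) :
    ((dyadicIndex m '' A x).encard : ℝ≥0∞) =
      ∑' k, {y | (A y ∩ dyadicCell m k).Nonempty}.indicator 1 x := by
  rw [← ENNReal.tsum_set_one, tsum_subtype (dyadicIndex m '' A x) fun _ => 1]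
  rfl

lemma encard_eq_iSup_tsum_indicator (x : X) :
    ((A x).encard : ℝ≥0∞) =
      ⨆ m, ∑' k, {y | (A y ∩ dyadicCell m k).Nonempty}.indicator 1 x := by
  simp only [encard_eq_iSup_encard_image_dyadicIndex (A x), ENat.toENNReal_iSup,
    encard_image_dyadicIndex_eq_tsum]

lemma encard_le_liminf_tsum_indicator (x : X) :
    ((A x).encard : ℝ≥0∞) ≤
      Filter.liminf (fun m => ∑' k, {y | (A y ∩ dyadicCell m k).Nonempty}.indicator 1 x)
        Filter.atTop := by
  simp only [encard_eq_iSup_encard_image_dyadicIndex (A x), ENat.toENNReal_iSup,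
    ← encard_image_dyadicIndex_eq_tsum]
  refine iSup_le fun m => Filter.le_liminf_of_le (h := ?_)
  filter_upwards [Filter.eventually_ge_atTop m] with n hn
  exact ENat.toENNReal_le.2 (encard_image_dyadicIndex_mono _ hn)

variable {A} [MeasurableSpace X]

lemma measurable_encard
    (h : ∀ m k, MeasurableSet {x | (A x ∩ dyadicCell m k).Nonempty}) :
    Measurable fun x => ((A x).encard : ℝ≥0∞) := by
  simp only [encard_eq_iSup_tsum_indicator]
  exact .iSup fun m => .tsum fun k => measurable_one.indicator (h m k)

end

section

variable {X T E : Type*} [MeasurableSpace X] [TopologicalSpace T] [MetricSpace E] {S : Set X}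
  {Z : X → T → E} {K : Set T}

lemma exists_mem_eq_iff_forall_exists_dist_lt {z : T → E} (hz : Continuous z) (hK : IsCompact K)
    {D : Set T} (hDK : D ⊆ K) (hKD : K ⊆ closure D) (c : E) :
    (∃ t ∈ K, z t = c) ↔ ∀ n : ℕ, ∃ q ∈ D, dist (z q) c < 1 / (n + 1 : ℝ) := by
  have hd : Continuous fun t => dist (z t) c := by fun_prop
  constructor
  · rintro ⟨t, ht, rfl⟩ n
    obtain ⟨q, hq, hqD⟩ := mem_closure_iff.1 (hKD ht) {q | dist (z q) (z t) < 1 / (n + 1 : ℝ)}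
      (isOpen_lt hd continuous_const) (by simpa using Nat.cast_add_one_pos n)
    exact ⟨q, hqD, hq⟩
  · intro h
    obtain ⟨q, hqD, -⟩ := h 0
    obtain ⟨t, ht, hmin⟩ := hK.exists_isMinOn ⟨q, hDK hqD⟩ hd.continuousOn
    refine ⟨t, ht, dist_le_zero.1 (le_of_forall_pos_lt_add fun ε hε => ?_)⟩
    obtain ⟨n, hn⟩ := exists_nat_one_div_lt hε
    obtain ⟨q, hqD, hq⟩ := h n
    rw [zero_add]
    exact (hmin (hDK hqD)).trans_lt (hq.trans hn)

variable [TopologicalSpace.PseudoMetrizableSpace T] [MeasurableSpace E] [OpensMeasurableSpace E]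

lemma measurableSet_exists_mem_eq_of_isCompact (hS : MeasurableSet S)
    (hc : ∀ x ∈ S, Continuous (Z x)) (hm : ∀ t, Measurable fun x => Z x t) (hK : IsCompact K)
    (c : E) : MeasurableSet {x | x ∈ S ∧ ∃ t ∈ K, Z x t = c} := by
  obtain ⟨D, hDK, hD, hKD⟩ := hK.isSeparable.exists_countable_dense_subset
  have h : {x | x ∈ S ∧ ∃ t ∈ K, Z x t = c} =
      S ∩ ⋂ n : ℕ, ⋃ q ∈ D, (fun x => Z x q) ⁻¹' Metric.ball c (1 / (n + 1 : ℝ)) := by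
    ext x
    simp only [mem_ofPred_eq, mem_inter_iff, mem_iInter, mem_iUnion, mem_preimage, Metric.mem_ball,
      exists_prop]
    exact and_congr_right fun hx =>
      exists_mem_eq_iff_forall_exists_dist_lt (hc x hx) hK hDK hKD c
  rw [h]
  exact hS.inter <| .iInter fun n => .biUnion hD fun q _ => hm q Metric.isOpen_ball.measurableSet

lemma measurableSet_exists_mem_eq_of_isSigmaCompact (hS : MeasurableSet S)
    (hc : ∀ x ∈ S, Continuous (Z x)) (hm : ∀ t, Measurable fun x => Z x t)
    (hK : IsSigmaCompact K) (c : E) : MeasurableSet {x | x ∈ S ∧ ∃ t ∈ K, Z x t = c} := by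
  obtain ⟨C, hC, rfl⟩ := hK
  have h : {x | x ∈ S ∧ ∃ t ∈ ⋃ n, C n, Z x t = c} =
      ⋃ n, {x | x ∈ S ∧ ∃ t ∈ C n, Z x t = c} := by
    ext x
    simp only [mem_ofPred_eq, mem_iUnion]
    tauto
  rw [h]
  exact .iUnion fun n => measurableSet_exists_mem_eq_of_isCompact hS hc hm (hC n) c

end

lemma isSigmaCompact_inter_dyadicCell {K : Set ℝ} (hK : IsCompact K) (m : ℕ) (k : ℤ) :
    IsSigmaCompact (K ∩ dyadicCell m k) := by
  obtain ⟨F, hF, -, hU, -⟩ := (isOpen_Iio (a := ((k : ℝ) + 1) / 2 ^ m)).exists_iUnion_isClosed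
  rw [dyadicCell_eq_Ici_inter_Iio, ← inter_assoc, ← hU, inter_iUnion]
  exact isSigmaCompact_iUnion_of_isCompact _ fun n =>
    (hK.inter_right isClosed_Ici).inter_right (hF n)

lemma measurable_indicator_crossingCount {X : Type*} [MeasurableSpace X] {S : Set X}
    (hS : MeasurableSet S) {Z : X → ℝ → ℝ} (hc : ∀ x ∈ S, Continuous (Z x))
    (hm : ∀ t, Measurable fun x => Z x t) (c a b : ℝ) :
    Measurable (S.indicator fun x => (crossingCount (Z x) c a b : ℝ≥0∞)) := by
  have h : (S.indicator fun x => (crossingCount (Z x) c a b : ℝ≥0∞)) =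
      fun x => ({t | x ∈ S ∧ t ∈ Icc a b ∧ Z x t = c}.encard : ℝ≥0∞) := by
    ext x
    by_cases hx : x ∈ S <;> simp [hx, crossingCount]
  rw [h]
  refine measurable_encard fun m k => ?_
  convert measurableSet_exists_mem_eq_of_isSigmaCompact hS hc hm
    (isSigmaCompact_inter_dyadicCell (isCompact_Icc (a := a) (b := b)) m k) c using 1
  ext x
  simp only [mem_ofPred_eq, Set.Nonempty, mem_inter_iff]
  exact ⟨fun ⟨t, ⟨hx, ht, e⟩, htk⟩ => ⟨hx, t, ⟨ht, htk⟩, e⟩,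
    fun ⟨hx, t, ⟨ht, htk⟩, e⟩ => ⟨t, ⟨hx, ht, e⟩, htk⟩⟩

lemma measurable_enat_iff {α : Type*} [MeasurableSpace α] {f : α → ℕ∞} :
    Measurable f ↔ Measurable fun a => (f a : ℝ≥0∞) := by
  refine ⟨fun h => (measurable_of_countable _).comp h, fun h => ENat.measurable_iff.2 fun n => ?_⟩
  have hn : f ⁻¹' {(n : ℕ∞)} = (fun a => (f a : ℝ≥0∞)) ⁻¹' {(n : ℝ≥0∞)} := by
    ext a
    simp only [mem_preimage, mem_singleton_iff, ← ENat.toENNReal_coe, ENat.toENNReal_inj]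
  rw [hn]
  exact h (measurableSet_singleton _)

/-! ### Crossings of a sum with a translated kernel -/

section

variable {f φ : ℝ → ℝ} {P B : Set ℝ} {a b c : ℝ}

lemma ediam_le_volume_of_ordConnected (hP : P.OrdConnected) : Metric.ediam P ≤ volume P := by
  refine Metric.ediam_le fun x hx y hy => ?_
  rw [edist_comm, edist_dist, Real.dist_eq, ← Real.volume_interval]
  exact measure_mono (hP.uIcc_subset hx hy)

open scoped Pointwise in
lemma volume_sub_le_of_ordConnected {Q : Set ℝ} (hP : P.OrdConnected) (hQ : Q.OrdConnected) :
    volume (P - Q) ≤ volume P + volume Q := by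
  calc volume (P - Q) ≤ Metric.ediam (P + -Q) := by
        rw [sub_eq_add_neg]
        exact Real.volume_le_diam _
    _ ≤ Metric.ediam P + Metric.ediam (-Q) := ediam_add_le _ _
    _ = Metric.ediam P + Metric.ediam Q := congrArg _ ((IsometryEquiv.neg ℝ).ediam_preimage Q)
    _ ≤ volume P + volume Q :=
      add_le_add (ediam_le_volume_of_ordConnected hP) (ediam_le_volume_of_ordConnected hQ)

/-- The positions `u` in the branch `B` for which `f + φ u` attains the level `c` on `P`. If
`f + φ (· - x)` attains the level `c` at `t ∈ P` with `t - x ∈ B`, then `x` lies in the difference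
of `P` and this set. -/
def hitPositions (f φ : ℝ → ℝ) (c : ℝ) (P B : Set ℝ) : Set ℝ :=
  {u | u ∈ B ∧ ∃ t ∈ P, f t + φ u = c}

lemma ordConnected_hitPositions (hf : Continuous f) (hP : P.OrdConnected) (hB : B.OrdConnected)
    (hφ : MonotoneOn φ B ∨ AntitoneOn φ B) : (hitPositions f φ c P B).OrdConnected := by
  refine ⟨?_⟩
  rintro u₁ ⟨hu₁, t₁, ht₁, e₁⟩ u₂ ⟨hu₂, t₂, ht₂, e₂⟩ u hu
  have huB := hB.out hu₁ hu₂ hu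
  have hfP : (f '' P).OrdConnected :=
    (hP.isPreconnected.image f hf.continuousOn).ordConnected
  have hmem : c - φ u ∈ uIcc (f t₁) (f t₂) := by
    rw [mem_uIcc]
    rcases hφ with h | h
    · right
      constructor <;> linarith [h hu₁ huB hu.1, h huB hu₂ hu.2]
    · left
      constructor <;> linarith [h hu₁ huB hu.1, h huB hu₂ hu.2]
  obtain ⟨t, ht, e⟩ := hfP.uIcc_subset ⟨t₁, ht₁, rfl⟩ ⟨t₂, ht₂, rfl⟩ hmem
  exact ⟨huB, t, ht, by rw [e, sub_add_cancel]⟩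

lemma tsum_volume_inter_dyadicCell (P : Set ℝ) (m : ℕ) :
    ∑' k, volume (P ∩ dyadicCell m k) = volume P := by
  have hm : ∀ k, MeasurableSet (dyadicCell m k) := fun k =>
    (ordConnected_dyadicCell m k).measurableSet
  have h := tsum_measure_preimage_singleton (μ := volume.restrict P) countable_univ
    (f := dyadicIndex m) fun k _ => hm k
  rw [tsum_univ (fun k => volume.restrict P (dyadicIndex m ⁻¹' {k})), preimage_univ,
    Measure.restrict_apply_univ] at h
  rw [← h]
  exact tsum_congr fun k => by
    rw [← dyadicCell, Measure.restrict_apply (hm k), inter_comm]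

lemma tsum_volume_hitPositions_le (hf : Continuous f) (hB : B.OrdConnected)
    (hφ : MonotoneOn φ B ∨ AntitoneOn φ B) (m : ℕ) :
    ∑' k, volume (hitPositions f φ c (Icc a b ∩ dyadicCell m k) B) ≤
      ∫⁻ u in B, (crossingCount (fun t => f t + φ u) c a b : ℝ≥0∞) := by
  have hm : ∀ k, MeasurableSet (hitPositions f φ c (Icc a b ∩ dyadicCell m k) B) := fun k =>
    (ordConnected_hitPositions hf (ordConnected_Icc.inter (ordConnected_dyadicCell m k)) hB
      hφ).measurableSet
  calc ∑' k, volume (hitPositions f φ c (Icc a b ∩ dyadicCell m k) B)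
      = ∑' k, ∫⁻ u in B, (hitPositions f φ c (Icc a b ∩ dyadicCell m k) B).indicator 1 u := by
        refine tsum_congr fun k => ?_
        rw [lintegral_indicator_one (hm k), Measure.restrict_apply (hm k)]
        exact congrArg volume (inter_eq_left.2 fun u hu => hu.1).symm
    _ = ∫⁻ u in B, ∑' k, (hitPositions f φ c (Icc a b ∩ dyadicCell m k) B).indicator 1 u :=
        (lintegral_tsum fun k => (measurable_one.indicator (hm k)).aemeasurable).symm
    _ ≤ ∫⁻ u in B, (crossingCount (fun t => f t + φ u) c a b : ℝ≥0∞) := by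
        refine lintegral_mono fun u => ?_
        rw [crossingCount, encard_eq_iSup_tsum_indicator
          fun u => {t | t ∈ Icc a b ∧ f t + φ u = c}]
        refine le_iSup_of_le m (ENNReal.tsum_le_tsum fun k => ?_)
        refine indicator_le_indicator_of_subset ?_ (fun _ => zero_le_one) u
        rintro u ⟨-, t, ⟨ht, htk⟩, e⟩
        exact ⟨t, ⟨ht, e⟩, htk⟩

open scoped Pointwise in
lemma measurableSet_sub_hitPositions (hf : Continuous f) (hP : P.OrdConnected)
    (hB : B.OrdConnected) (hφ : MonotoneOn φ B ∨ AntitoneOn φ B) :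
    MeasurableSet (P - hitPositions f φ c P B) :=
  (hP.convex.sub (ordConnected_hitPositions hf hP hB hφ).convex).ordConnected.measurableSet

open scoped Pointwise in
lemma tsum_volume_sub_hitPositions_le (hf : Continuous f) (hB : B.OrdConnected)
    (hφ : MonotoneOn φ B ∨ AntitoneOn φ B) (m : ℕ) :
    ∑' k, volume (Icc a b ∩ dyadicCell m k - hitPositions f φ c (Icc a b ∩ dyadicCell m k) B) ≤
      ENNReal.ofReal (b - a) + ∫⁻ u in B, (crossingCount (fun t => f t + φ u) c a b : ℝ≥0∞) := by
  have hP : ∀ k, (Icc a b ∩ dyadicCell m k).OrdConnected := fun k =>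
    ordConnected_Icc.inter (ordConnected_dyadicCell m k)
  refine (ENNReal.tsum_le_tsum fun k => volume_sub_le_of_ordConnected (hP k)
    (ordConnected_hitPositions hf (hP k) hB hφ)).trans ?_
  rw [ENNReal.tsum_add, tsum_volume_inter_dyadicCell, Real.volume_Icc]
  gcongr
  exact tsum_volume_hitPositions_le hf hB hφ m

open scoped Pointwise in
lemma crossingCount_translate_le_liminf {ι : Type*} [Fintype ι] {B : ι → Set ℝ} {x : ℝ}
    (hx : ∀ t ∈ Icc a b, t - x ∈ ⋃ i, B i) :
    (crossingCount (fun t => f t + φ (t - x)) c a b : ℝ≥0∞) ≤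
      Filter.liminf (fun m => ∑ i, ∑' k, (Icc a b ∩ dyadicCell m k -
        hitPositions f φ c (Icc a b ∩ dyadicCell m k) (B i)).indicator 1 x) Filter.atTop := by
  refine (encard_le_liminf_tsum_indicator
    (fun x => {t | t ∈ Icc a b ∧ f t + φ (t - x) = c}) x).trans ?_
  refine Filter.liminf_le_liminf (.of_forall fun m => ?_)
  rw [← Summable.tsum_finsetSum fun _ _ => ENNReal.summable]
  refine ENNReal.tsum_le_tsum fun k => indicator_apply_le' (fun ⟨t, ⟨ht, e⟩, htk⟩ => ?_)
    fun _ => zero_le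
  obtain ⟨i, hi⟩ := mem_iUnion.1 (hx t ht)
  have hxD : x ∈ Icc a b ∩ dyadicCell m k - hitPositions f φ c (Icc a b ∩ dyadicCell m k) (B i) :=
    mem_sub.2 ⟨t, ⟨ht, htk⟩, t - x, ⟨hi, t, ⟨ht, htk⟩, e⟩, sub_sub_cancel t x⟩
  refine le_trans ?_ (Finset.single_le_sum (fun _ _ => zero_le) (Finset.mem_univ i))
  exact (indicator_of_mem hxD _).ge

-- On a short interval `P` the crossings are counted by `x ∈ P - hitPositions f φ c P (B i)`, an
-- interval no longer than `P` and `hitPositions f φ c P (B i)` together. Summed over `P`, these two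
-- lengths give the two terms of the bound.
theorem lintegral_crossingCount_translate_le {ι : Type*} [Fintype ι] {B : ι → Set ℝ}
    (hf : Continuous f) (hB : ∀ i, (B i).OrdConnected)
    (hφ : ∀ i, MonotoneOn φ (B i) ∨ AntitoneOn φ (B i)) {W : Set ℝ} (hW : MeasurableSet W)
    (hWB : ∀ x ∈ W, ∀ t ∈ Icc a b, t - x ∈ ⋃ i, B i) :
    ∫⁻ x in W, (crossingCount (fun t => f t + φ (t - x)) c a b : ℝ≥0∞) ≤
      Fintype.card ι * ENNReal.ofReal (b - a) +
        ∑ i, ∫⁻ u in B i, (crossingCount (fun t => f t + φ u) c a b : ℝ≥0∞) := by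
  open scoped Pointwise in
  set D : ℕ → ℤ → ι → Set ℝ := fun m k i => Icc a b ∩ dyadicCell m k -
    hitPositions f φ c (Icc a b ∩ dyadicCell m k) (B i)
  have hD : ∀ m k i, MeasurableSet (D m k i) := fun m k i => measurableSet_sub_hitPositions hf
    (ordConnected_Icc.inter (ordConnected_dyadicCell m k)) (hB i) (hφ i)
  have hDm : ∀ m i, Measurable fun x => ∑' k, (D m k i).indicator (1 : ℝ → ℝ≥0∞) x := fun m i =>
    .tsum fun k => measurable_one.indicator (hD m k i)
  have hint : ∀ m, ∫⁻ x, ∑ i, ∑' k, (D m k i).indicator 1 x ≤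
      Fintype.card ι * ENNReal.ofReal (b - a) +
        ∑ i, ∫⁻ u in B i, (crossingCount (fun t => f t + φ u) c a b : ℝ≥0∞) := by
    intro m
    calc ∫⁻ x, ∑ i, ∑' k, (D m k i).indicator 1 x = ∑ i, ∑' k, volume (D m k i) := by
          rw [lintegral_finsetSum _ fun i _ => hDm m i]
          refine Finset.sum_congr rfl fun i _ => ?_
          rw [lintegral_tsum fun k => (measurable_one.indicator (hD m k i)).aemeasurable]
          exact tsum_congr fun k => lintegral_indicator_one (hD m k i)
      _ ≤ ∑ i, (ENNReal.ofReal (b - a) +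
            ∫⁻ u in B i, (crossingCount (fun t => f t + φ u) c a b : ℝ≥0∞)) :=
          Finset.sum_le_sum fun i _ => tsum_volume_sub_hitPositions_le hf (hB i) (hφ i) m
      _ = _ := by rw [Finset.sum_add_distrib, Finset.sum_const, Finset.card_univ, nsmul_eq_mul]
  calc ∫⁻ x in W, (crossingCount (fun t => f t + φ (t - x)) c a b : ℝ≥0∞)
      ≤ ∫⁻ x in W, Filter.liminf (fun m => ∑ i, ∑' k, (D m k i).indicator 1 x) Filter.atTop :=
        setLIntegral_mono' hW fun x hx => crossingCount_translate_le_liminf (hWB x hx)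
    _ ≤ ∫⁻ x, Filter.liminf (fun m => ∑ i, ∑' k, (D m k i).indicator 1 x) Filter.atTop :=
        setLIntegral_le_lintegral _ _
    _ ≤ Filter.liminf (fun m => ∫⁻ x, ∑ i, ∑' k, (D m k i).indicator 1 x) Filter.atTop :=
        lintegral_liminf_le fun m => Finset.measurable_fun_sum _ fun i _ => hDm m i
    _ ≤ _ := Filter.liminf_le_of_le (h := fun d hd =>
        let ⟨m, hm⟩ := hd.exists
        hm.trans (hint m))

end

/-! ### Elementary properties of crossing counts -/

lemma crossingCount_add_const (f : ℝ → ℝ) (d c a b : ℝ) :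
    crossingCount (fun t => f t + d) c a b = crossingCount f (c - d) a b := by
  simp only [crossingCount, eq_sub_iff_add_eq]

lemma crossingCount_comp_add (f : ℝ → ℝ) (s c a b : ℝ) :
    crossingCount (fun t => f (t + s)) c a b = crossingCount f c (a + s) (b + s) := by
  unfold crossingCount
  rw [← (add_left_injective s).encard_image]
  congr 1
  ext t
  simp only [mem_image, mem_ofPred_eq, mem_Icc]
  constructor
  · rintro ⟨u, ⟨⟨h1, h2⟩, h3⟩, rfl⟩
    exact ⟨⟨by linarith, by linarith⟩, h3⟩
  · rintro ⟨⟨h1, h2⟩, h3⟩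
    exact ⟨t - s, ⟨⟨by linarith, by linarith⟩, by rwa [sub_add_cancel]⟩, sub_add_cancel t s⟩

lemma crossingCount_le_add (f : ℝ → ℝ) (c a b d : ℝ) :
    crossingCount f c a d ≤ crossingCount f c a b + crossingCount f c b d := by
  refine (encard_le_encard ?_).trans (encard_union_le _ _)
  rintro t ⟨⟨h1, h2⟩, h3⟩
  exact (le_total t b).imp (fun h => ⟨⟨h1, h⟩, h3⟩) fun h => ⟨⟨h, h2⟩, h3⟩

lemma crossingCount_add_le {f : ℝ → ℝ} {c a b d : ℝ} (hf : f b ≠ c) (hab : a ≤ b) (hbd : b ≤ d) :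
    crossingCount f c a b + crossingCount f c b d ≤ crossingCount f c a d := by
  unfold crossingCount
  rw [← encard_union_eq]
  · refine encard_le_encard ?_
    rintro t (⟨⟨h1, h2⟩, h3⟩ | ⟨⟨h1, h2⟩, h3⟩)
    · exact ⟨⟨h1, h2.trans hbd⟩, h3⟩
    · exact ⟨⟨hab.trans h1, h2⟩, h3⟩
  · refine disjoint_left.2 fun t h1 h2 => hf ?_
    rw [le_antisymm h2.1.1 h1.1.2]
    exact h2.2

lemma sum_crossingCount_le {f : ℝ → ℝ} {c : ℝ} (hf : ∀ k : ℕ, f k ≠ c) (n : ℕ) :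
    ∑ k ∈ Finset.range n, crossingCount f c k (k + 1) ≤ crossingCount f c 0 n := by
  induction n with
  | zero => simp
  | succ n ih =>
    rw [Finset.sum_range_succ, Nat.cast_succ]
    exact (add_le_add_left ih _).trans (crossingCount_add_le (hf n) n.cast_nonneg (by linarith))

lemma crossingCount_le_sum (f : ℝ → ℝ) (c : ℝ) {n : ℕ} (hn : 1 ≤ n) :
    crossingCount f c 0 n ≤ ∑ k ∈ Finset.range n, crossingCount f c k (k + 1) := by
  induction n, hn using Nat.le_induction with
  | base => simp
  | succ n hn ih =>
    rw [Finset.sum_range_succ, Nat.cast_succ]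
    exact (crossingCount_le_add f c 0 n (n + 1)).trans (add_le_add_left ih _)

lemma crossingCount_le_crossingCount_deriv_add_one {f f' : ℝ → ℝ}
    (hf : ∀ t, HasDerivAt f (f' t) t) (c a b : ℝ) :
    crossingCount f c a b ≤ crossingCount f' 0 a b + 1 := by
  unfold crossingCount
  rcases {t | t ∈ Icc a b ∧ f' t = 0}.finite_or_infinite with hT | hT
  · refine ENat.forall_natCast_le_iff_le.1 fun n hn => ?_
    obtain ⟨s, hsA, hs⟩ := exists_subset_encard_eq hn
    have hfin : s.Finite := finite_of_encard_eq_coe hs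
    rw [← hs, hfin.encard_eq_coe_toFinset_card, hT.encard_eq_coe_toFinset_card]
    norm_cast
    refine Finset.card_le_of_interleaved fun x hx y hy hxy _ => ?_
    have hx' := hsA (hfin.mem_toFinset.1 hx)
    have hy' := hsA (hfin.mem_toFinset.1 hy)
    obtain ⟨z, hz, hz0⟩ := exists_hasDerivAt_eq_zero hxy
      (fun t _ => (hf t).continuousAt.continuousWithinAt) (hx'.2.trans hy'.2.symm) fun t _ => hf t
    exact ⟨z, hT.mem_toFinset.2 ⟨⟨hx'.1.1.trans hz.1.le, hz.2.le.trans hy'.1.2⟩, hz0⟩, hz⟩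
  · rw [hT.encard_eq, top_add]
    exact le_top

lemma sum_crossingCount_le_sum_crossingCount_deriv_add_one {f f' : ℝ → ℝ} {c : ℝ}
    (hf : ∀ t, HasDerivAt f (f' t) t) (hc : ∀ k : ℕ, f k ≠ c) {n : ℕ} (hn : 1 ≤ n) :
    ∑ k ∈ Finset.range n, crossingCount f c k (k + 1) ≤
      ∑ k ∈ Finset.range n, crossingCount f' 0 k (k + 1) + 1 :=
  calc ∑ k ∈ Finset.range n, crossingCount f c k (k + 1) ≤ crossingCount f c 0 n :=
        sum_crossingCount_le hc n
    _ ≤ crossingCount f' 0 0 n + 1 := crossingCount_le_crossingCount_deriv_add_one hf c 0 n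
    _ ≤ _ := add_le_add_left (crossingCount_le_sum f' 0 hn) 1

/-! ### Multiple zeros of a sum with a translated kernel -/

section

variable {f f' φ φ' : ℝ → ℝ}

lemma volume_image_setOf_hasDerivAt_zero (θ : ℝ → ℝ) :
    volume (θ '' {t | HasDerivAt θ 0 t}) = 0 := by
  refine addHaar_image_eq_zero_of_det_fderivWithin_eq_zero volume (f' := fun _ => 0)
    (fun t ht => ?_) fun t _ => ?_
  · simpa using (show HasDerivAt θ 0 t from ht).hasFDerivAt.hasFDerivWithinAt
  · simp [ContinuousLinearMap.det]

-- If `ψ` is the local inverse of the kernel, the positions in question are critical values of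
-- `t ↦ t - ψ (-f t)`.
lemma volume_exists_tangent_source_eq_zero (hf : ∀ t, HasDerivAt f (f' t) t)
    (e : OpenPartialHomeomorph ℝ ℝ) (he : ∀ u, HasDerivAt e (φ' u) u) :
    volume {x | ∃ t, t - x ∈ e.source ∧ φ' (t - x) ≠ 0 ∧ f t + e (t - x) = 0 ∧
      f' t + φ' (t - x) = 0} = 0 := by
  refine measure_mono_null ?_ (volume_image_setOf_hasDerivAt_zero fun t => t - e.symm (-f t))
  rintro x ⟨t, hsource, hne, hzero, hzero'⟩
  have hft : -f t = e (t - x) := neg_eq_of_add_eq_zero_right hzero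
  have hinv : e.symm (-f t) = t - x := by rw [hft, e.left_inv hsource]
  have hsymm : HasDerivAt e.symm (φ' (t - x))⁻¹ (-f t) :=
    e.hasDerivAt_symm (hft ▸ e.map_source hsource) hne (hinv ▸ he _)
  refine ⟨t, ?_, by simp only [hinv, sub_sub_cancel]⟩
  refine ((hasDerivAt_id t).sub (hsymm.comp t (hf t).neg)).congr_deriv ?_
  rw [neg_eq_of_add_eq_zero_right hzero', inv_mul_cancel₀ hne, sub_self]

lemma volume_exists_tangent_noncritical_eq_zero (hf : ∀ t, HasDerivAt f (f' t) t)
    (hφ : ∀ u, HasStrictDerivAt φ (φ' u) u) :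
    volume {x | ∃ t, φ' (t - x) ≠ 0 ∧ f t + φ (t - x) = 0 ∧ f' t + φ' (t - x) = 0} = 0 := by
  have hloc : ∀ u ∈ {u | φ' u ≠ 0}, ∃ e : OpenPartialHomeomorph ℝ ℝ, u ∈ e.source ∧ ⇑e = φ :=
    fun u hu => ⟨_, ((hφ u).hasStrictFDerivAt_equiv hu).mem_toOpenPartialHomeomorph_source,
      HasStrictFDerivAt.toOpenPartialHomeomorph_coe _⟩
  have : Nonempty (OpenPartialHomeomorph ℝ ℝ) := ⟨.refl ℝ⟩
  choose! e he hcoe using hloc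
  obtain ⟨s, hs, hsc, hcover⟩ := TopologicalSpace.countable_cover_nhdsWithin fun u hu =>
    mem_nhdsWithin_of_mem_nhds ((e u).open_source.mem_nhds (he u hu))
  refine measure_mono_null ?_ ((measure_biUnion_null_iff hsc).2 fun u hu =>
    volume_exists_tangent_source_eq_zero hf (e u) fun v => hcoe u (hs hu) ▸ (hφ v).hasDerivAt)
  rintro x ⟨t, hne, h⟩
  obtain ⟨u, hu, hmem⟩ := mem_iUnion₂.1 (hcover hne)
  exact mem_iUnion₂.2 ⟨u, hu, t, hmem, hne, by rwa [hcoe u (hs hu)]⟩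

theorem volume_exists_tangent_eq_zero (hf : ∀ t, HasDerivAt f (f' t) t)
    (hφ : ∀ u, HasStrictDerivAt φ (φ' u) u) (hcrit : {u | φ' u = 0}.Countable) {K : Set ℝ}
    (hK : ∀ u, φ' u = 0 → {t | t ∈ K ∧ f t = -φ u}.Countable) :
    volume {x | ∃ t ∈ K, f t + φ (t - x) = 0 ∧ f' t + φ' (t - x) = 0} = 0 := by
  have hcount : (⋃ u ∈ {u | φ' u = 0}, (· - u) '' {t | t ∈ K ∧ f t = -φ u}).Countable :=
    hcrit.biUnion fun u hu => (hK u hu).image _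
  refine measure_mono_null ?_ (measure_union_null
    (volume_exists_tangent_noncritical_eq_zero hf hφ) (hcount.measure_zero volume))
  rintro x ⟨t, ht, h, h'⟩
  by_cases hu : φ' (t - x) = 0
  · exact Or.inr (mem_biUnion hu ⟨t, ⟨ht, eq_neg_of_add_eq_zero_left h⟩, sub_sub_cancel t x⟩)
  · exact Or.inl ⟨t, hu, h, h'⟩

end

lemma isLocalExtr_iff_deriv_eq_zero {f : ℝ → ℝ} {t : ℝ} (hf : ContinuousAt f t)
    (h : ¬(deriv f t = 0 ∧ deriv (deriv f) t = 0)) : IsLocalExtr f t ↔ deriv f t = 0 := by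
  refine ⟨IsLocalExtr.deriv_eq_zero, fun h0 => ?_⟩
  rcases lt_or_gt_of_ne fun h2 => h ⟨h0, h2⟩ with h2 | h2
  · exact Or.inr (isLocalMax_of_deriv_deriv_neg h2 h0 hf)
  · exact Or.inl (isLocalMin_of_deriv_deriv_pos h2 h0 hf)

/-! ### The Gaussian kernel -/

/-- The first derivative of the Gaussian kernel of width `σ`. -/
def gaussianKernelDeriv (σ u : ℝ) : ℝ := -(u / σ ^ 2) * gaussianKernel σ u

/-- The second derivative of the Gaussian kernel of width `σ`, which is negative on `(-σ, σ)` and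
positive outside `[-σ, σ]`. -/
def gaussianKernelDerivTwo (σ u : ℝ) : ℝ := (u ^ 2 / σ ^ 2 - 1) / σ ^ 2 * gaussianKernel σ u

/-- Kernels bounded by a multiple of `1 / (1 + u ^ 2)`. Their sums over the points of a Poisson
process converge, because the points have linear growth. -/
def HasQuadraticDecay (φ : ℝ → ℝ) : Prop := ∃ C, ∀ u, |φ u| ≤ C * (1 + u ^ 2)⁻¹

section

variable {σ u : ℝ}

lemma gaussianKernel_pos (hσ : 0 < σ) (u : ℝ) : 0 < gaussianKernel σ u := by
  unfold gaussianKernel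
  positivity

lemma hasStrictDerivAt_gaussianKernel (σ u : ℝ) :
    HasStrictDerivAt (gaussianKernel σ) (gaussianKernelDeriv σ u) u := by
  have hexponent : HasStrictDerivAt (fun u : ℝ => -u ^ 2 / (2 * σ ^ 2)) (-(u / σ ^ 2)) u := by
    refine (((hasStrictDerivAt_id u).pow 2).neg.div_const _).congr_deriv ?_
    simp only [id_eq]
    ring
  refine (hexponent.exp.const_mul _).congr_deriv ?_
  unfold gaussianKernelDeriv gaussianKernel
  ring

lemma hasStrictDerivAt_gaussianKernelDeriv (σ u : ℝ) :
    HasStrictDerivAt (gaussianKernelDeriv σ) (gaussianKernelDerivTwo σ u) u := by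
  refine (((hasStrictDerivAt_id u).div_const _).neg.mul
    (hasStrictDerivAt_gaussianKernel σ u)).congr_deriv ?_
  unfold gaussianKernelDerivTwo gaussianKernelDeriv
  simp only [Pi.neg_apply, id_eq]
  ring

lemma continuous_gaussianKernel (σ : ℝ) : Continuous (gaussianKernel σ) :=
  continuous_iff_continuousAt.2 fun u =>
    (hasStrictDerivAt_gaussianKernel σ u).hasDerivAt.continuousAt

lemma continuous_gaussianKernelDeriv (σ : ℝ) : Continuous (gaussianKernelDeriv σ) :=
  continuous_iff_continuousAt.2 fun u =>
    (hasStrictDerivAt_gaussianKernelDeriv σ u).hasDerivAt.continuousAt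

lemma continuous_gaussianKernelDerivTwo (σ : ℝ) : Continuous (gaussianKernelDerivTwo σ) :=
  (((continuous_pow 2).div_const _).sub continuous_const |>.div_const _).mul
    (continuous_gaussianKernel σ)

lemma gaussianKernelDerivTwo_pos_iff (hσ : 0 < σ) : 0 < gaussianKernelDerivTwo σ u ↔ σ < |u| := by
  rw [gaussianKernelDerivTwo, mul_pos_iff_of_pos_right (gaussianKernel_pos hσ u),
    div_pos_iff_of_pos_right (pow_pos hσ 2), sub_pos, one_lt_div (pow_pos hσ 2), sq_lt_sq,
    abs_of_pos hσ]

lemma gaussianKernelDerivTwo_eq_zero_iff (hσ : 0 < σ) :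
    gaussianKernelDerivTwo σ u = 0 ↔ |u| = σ := by
  rw [gaussianKernelDerivTwo, mul_eq_zero_iff_right (gaussianKernel_pos hσ u).ne',
    div_eq_zero_iff, or_iff_left (pow_pos hσ 2).ne', sub_eq_zero, div_eq_one_iff_eq
    (pow_pos hσ 2).ne', sq_eq_sq_iff_abs_eq_abs, abs_of_pos hσ]

lemma gaussianKernelDerivTwo_neg_iff (hσ : 0 < σ) : gaussianKernelDerivTwo σ u < 0 ↔ |u| < σ := by
  rw [← not_le, le_iff_lt_or_eq, eq_comm, gaussianKernelDerivTwo_pos_iff hσ,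
    gaussianKernelDerivTwo_eq_zero_iff hσ, eq_comm, ← le_iff_lt_or_eq, not_le]

lemma countable_setOf_gaussianKernelDerivTwo_eq_zero (hσ : 0 < σ) :
    {u | gaussianKernelDerivTwo σ u = 0}.Countable := by
  refine (Set.toFinite {σ, -σ}).countable.mono fun u hu => ?_
  exact eq_or_eq_neg_of_abs_eq ((gaussianKernelDerivTwo_eq_zero_iff hσ).1 hu)

/-- The intervals of monotonicity of the derivative of the Gaussian kernel. -/
def monotonicityInterval (σ : ℝ) : Fin 3 → Set ℝ := ![Iio (-σ), Icc (-σ) σ, Ioi σ]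

lemma ordConnected_monotonicityInterval (σ : ℝ) :
    ∀ i, (monotonicityInterval σ i).OrdConnected :=
  Fin.forall_fin_succ.2
    ⟨ordConnected_Iio, Fin.forall_fin_two.2 ⟨ordConnected_Icc, ordConnected_Ioi⟩⟩

lemma monotoneOn_or_antitoneOn_gaussianKernelDeriv (hσ : 0 < σ) (i : Fin 3) :
    MonotoneOn (gaussianKernelDeriv σ) (monotonicityInterval σ i) ∨
      AntitoneOn (gaussianKernelDeriv σ) (monotonicityInterval σ i) := by
  have hderiv : ∀ u, deriv (gaussianKernelDeriv σ) u = gaussianKernelDerivTwo σ u := fun u =>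
    (hasStrictDerivAt_gaussianKernelDeriv σ u).hasDerivAt.deriv
  have hdiff : Differentiable ℝ (gaussianKernelDeriv σ) := fun u =>
    (hasStrictDerivAt_gaussianKernelDeriv σ u).hasDerivAt.differentiableAt
  have hcont := continuous_gaussianKernelDeriv σ
  fin_cases i
  · refine Or.inl (monotoneOn_of_deriv_nonneg (convex_Iio _) hcont.continuousOn
      hdiff.differentiableOn fun u hu => ?_)
    rw [interior_Iio, mem_Iio] at hu
    rw [hderiv]
    exact ((gaussianKernelDerivTwo_pos_iff hσ).2 (lt_abs.2 (Or.inr (lt_neg_of_lt_neg hu)))).le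
  · refine Or.inr (antitoneOn_of_deriv_nonpos (convex_Icc _ _) hcont.continuousOn
      hdiff.differentiableOn fun u hu => ?_)
    rw [interior_Icc] at hu
    rw [hderiv]
    exact ((gaussianKernelDerivTwo_neg_iff hσ).2 (abs_lt.2 hu)).le
  · refine Or.inl (monotoneOn_of_deriv_nonneg (convex_Ioi _) hcont.continuousOn
      hdiff.differentiableOn fun u hu => ?_)
    rw [interior_Ioi, mem_Ioi] at hu
    rw [hderiv]
    exact ((gaussianKernelDerivTwo_pos_iff hσ).2 (lt_abs.2 (Or.inl hu))).le

lemma hasQuadraticDecay_mul_gaussianKernel (hσ : 0 < σ) {p : ℝ → ℝ} {A : ℝ}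
    (hp : ∀ u, |p u| ≤ A * (1 + u ^ 2)) : HasQuadraticDecay fun u => p u * gaussianKernel σ u := by
  refine ⟨A * (1 + 4 * σ ^ 2) ^ 2 * (1 / (σ * Real.sqrt (2 * Real.pi))), fun u => ?_⟩
  set E := Real.exp (u ^ 2 / (4 * σ ^ 2)) with hE
  have hA : 0 ≤ A := by simpa using (abs_nonneg _).trans (hp 0)
  have hkernel : gaussianKernel σ u = 1 / (σ * Real.sqrt (2 * Real.pi)) * (E ^ 2)⁻¹ := by
    rw [gaussianKernel, hE, ← Real.exp_nat_mul, ← Real.exp_neg]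
    congr 2
    push_cast
    field_simp
    norm_num
  have hgrowth : 1 + u ^ 2 ≤ (1 + 4 * σ ^ 2) * E :=
    calc 1 + u ^ 2 = 1 + 4 * σ ^ 2 * (u ^ 2 / (4 * σ ^ 2)) := by field_simp
      _ ≤ (1 + 4 * σ ^ 2) * (u ^ 2 / (4 * σ ^ 2) + 1) := by
        nlinarith [sq_nonneg σ, show 0 ≤ u ^ 2 / (4 * σ ^ 2) by positivity]
      _ ≤ (1 + 4 * σ ^ 2) * E := by
        gcongr
        exact Real.add_one_le_exp _
  have hE0 : 0 < E := Real.exp_pos _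
  rw [abs_mul, abs_of_pos (gaussianKernel_pos hσ u), hkernel, ← div_eq_mul_inv _ (1 + u ^ 2),
    le_div_iff₀ (by positivity)]
  calc |p u| * (1 / (σ * Real.sqrt (2 * Real.pi)) * (E ^ 2)⁻¹) * (1 + u ^ 2)
      ≤ A * (1 + u ^ 2) * (1 / (σ * Real.sqrt (2 * Real.pi)) * (E ^ 2)⁻¹) * (1 + u ^ 2) := by
        gcongr
        exact hp u
    _ = A * (1 + u ^ 2) ^ 2 * (1 / (σ * Real.sqrt (2 * Real.pi))) * (E ^ 2)⁻¹ := by ring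
    _ ≤ A * ((1 + 4 * σ ^ 2) * E) ^ 2 * (1 / (σ * Real.sqrt (2 * Real.pi))) * (E ^ 2)⁻¹ := by
        gcongr
    _ = A * (1 + 4 * σ ^ 2) ^ 2 * (1 / (σ * Real.sqrt (2 * Real.pi))) := by
        field_simp

lemma hasQuadraticDecay_gaussianKernel (hσ : 0 < σ) : HasQuadraticDecay (gaussianKernel σ) := by
  simpa only [one_mul] using hasQuadraticDecay_mul_gaussianKernel hσ (p := fun _ => 1) (A := 1)
    fun u => by simpa using sq_nonneg u

lemma hasQuadraticDecay_gaussianKernelDeriv (hσ : 0 < σ) :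
    HasQuadraticDecay (gaussianKernelDeriv σ) := by
  refine hasQuadraticDecay_mul_gaussianKernel hσ (A := 1 / σ ^ 2) fun u => ?_
  rw [abs_neg, abs_div, abs_of_pos (pow_pos hσ 2), div_mul_eq_mul_div, one_mul]
  gcongr
  nlinarith [sq_abs u, sq_nonneg (|u| - 1)]

lemma hasQuadraticDecay_gaussianKernelDerivTwo (hσ : 0 < σ) :
    HasQuadraticDecay (gaussianKernelDerivTwo σ) := by
  refine hasQuadraticDecay_mul_gaussianKernel hσ (A := (1 / σ ^ 2 + 1) / σ ^ 2) fun u => ?_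
  rw [abs_div, abs_of_pos (pow_pos hσ 2), div_mul_eq_mul_div]
  gcongr
  refine (abs_sub _ _).trans ?_
  rw [abs_one, abs_of_nonneg (by positivity)]
  nlinarith [sq_nonneg u, show 0 ≤ 1 / σ ^ 2 by positivity, div_eq_mul_one_div (u ^ 2) (σ ^ 2)]

end

/-! ### Smearing a measure by a kernel -/

/-- The measures against which every kernel of quadratic decay is integrable. -/
def IsTame (ν : Measure ℝ) : Prop := ∫⁻ x, ENNReal.ofReal (1 + x ^ 2)⁻¹ ∂ν < ∞

/-- The convolution of the kernel `φ` with the measure `ν`. For the counting measure of a point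
configuration this is the shot noise with kernel `φ`. -/
def smear (φ : ℝ → ℝ) (ν : Measure ℝ) (t : ℝ) : ℝ := ∫ x, φ (t - x) ∂ν

section

variable {φ φ' : ℝ → ℝ} {ν : Measure ℝ}

lemma measurableSet_isTame : MeasurableSet {ν | IsTame ν} :=
  measurableSet_lt (Measure.measurable_lintegral (by fun_prop)) measurable_const

lemma IsTame.add_dirac (hν : IsTame ν) (x : ℝ) : IsTame (ν + Measure.dirac x) := by
  rw [IsTame, lintegral_add_measure, lintegral_dirac' _ (by fun_prop)]
  exact ENNReal.add_lt_top.2 ⟨hν, ENNReal.ofReal_lt_top⟩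

lemma IsTame.integrable_inv_one_add_sq (hν : IsTame ν) : Integrable (fun x => (1 + x ^ 2)⁻¹) ν :=
  (lintegral_ofReal_ne_top_iff_integrable (by fun_prop)
    (.of_forall fun x => by positivity)).1 hν.ne

lemma HasQuadraticDecay.exists_abs_sub_le (hφ : HasQuadraticDecay φ) :
    ∃ C, 0 ≤ C ∧ ∀ t x, |φ (t - x)| ≤ C * (1 + t ^ 2) * (1 + x ^ 2)⁻¹ := by
  obtain ⟨C, hC⟩ := hφ
  have hC0 : 0 ≤ C := by simpa using (abs_nonneg _).trans (hC 0)
  refine ⟨C * 2, by positivity, fun t x => (hC _).trans ?_⟩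
  have hshift : (1 + (t - x) ^ 2)⁻¹ ≤ 2 * (1 + t ^ 2) * (1 + x ^ 2)⁻¹ := by
    rw [← div_eq_mul_inv, le_div_iff₀ (by positivity), inv_mul_le_iff₀ (by positivity)]
    nlinarith [sq_nonneg (t * (t - x)), sq_nonneg (t + (t - x))]
  calc C * (1 + (t - x) ^ 2)⁻¹ ≤ C * (2 * (1 + t ^ 2) * (1 + x ^ 2)⁻¹) := by gcongr
    _ = _ := by ring

lemma IsTame.integrable_comp_sub (hν : IsTame ν) (hφ : HasQuadraticDecay φ) (hc : Continuous φ)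
    (t : ℝ) : Integrable (fun x => φ (t - x)) ν := by
  obtain ⟨C, -, hC⟩ := hφ.exists_abs_sub_le
  exact (hν.integrable_inv_one_add_sq.const_mul (C * (1 + t ^ 2))).mono'
    (by fun_prop) (.of_forall (hC t))

lemma IsTame.exists_integrable_bound (hν : IsTame ν) (hφ : HasQuadraticDecay φ) (t : ℝ) :
    ∃ B : ℝ → ℝ, Integrable B ν ∧ ∀ s ∈ Metric.ball t 1, ∀ x, |φ (s - x)| ≤ B x := by
  obtain ⟨C, hC0, hC⟩ := hφ.exists_abs_sub_le
  refine ⟨fun x => C * (1 + (|t| + 1) ^ 2) * (1 + x ^ 2)⁻¹,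
    hν.integrable_inv_one_add_sq.const_mul _, fun s hs x => (hC s x).trans ?_⟩
  have hs' : |s| ≤ |t| + 1 := by
    linarith [abs_sub_abs_le_abs_sub s t, (Real.dist_eq s t).symm.trans_lt (Metric.mem_ball.1 hs)]
  have hsq : s ^ 2 ≤ (|t| + 1) ^ 2 := sq_abs s ▸ pow_le_pow_left₀ (abs_nonneg s) hs' 2
  beta_reduce
  gcongr

lemma IsTame.continuous_smear (hν : IsTame ν) (hφ : HasQuadraticDecay φ) (hc : Continuous φ) :
    Continuous (smear φ ν) := by
  refine continuous_iff_continuousAt.2 fun t => ?_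
  obtain ⟨B, hB, hbound⟩ := hν.exists_integrable_bound hφ t
  refine continuousAt_of_dominated (bound := B) (.of_forall fun s => by fun_prop) ?_ hB
    (.of_forall fun x => by fun_prop)
  filter_upwards [Metric.ball_mem_nhds t one_pos] with s hs
  exact .of_forall (hbound s hs)

lemma IsTame.hasDerivAt_smear (hν : IsTame ν) (hφ : HasQuadraticDecay φ)
    (hφ' : HasQuadraticDecay φ') (hc : Continuous φ') (hderiv : ∀ u, HasDerivAt φ (φ' u) u)
    (t : ℝ) : HasDerivAt (smear φ ν) (smear φ' ν t) t := by
  have hcφ : Continuous φ := continuous_iff_continuousAt.2 fun u => (hderiv u).continuousAt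
  obtain ⟨B, hB, hbound⟩ := hν.exists_integrable_bound hφ' t
  exact (hasDerivAt_integral_of_dominated_loc_of_deriv_le (F := fun s x => φ (s - x))
    (F' := fun s x => φ' (s - x)) (Metric.ball_mem_nhds t one_pos)
    (.of_forall fun s => by fun_prop) (hν.integrable_comp_sub hφ hcφ t) (by fun_prop)
    (.of_forall fun x s hs => hbound s hs x) hB
    (.of_forall fun x s _ => (hderiv (s - x)).comp_sub_const s x)).2

lemma IsTame.smear_add_dirac (hν : IsTame ν) (hφ : HasQuadraticDecay φ) (hc : Continuous φ)
    (x t : ℝ) : smear φ (ν + Measure.dirac x) t = smear φ ν t + φ (t - x) := by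
  rw [smear, integral_add_measure (hν.integrable_comp_sub hφ hc t) (integrable_dirac (by simp)),
    integral_dirac, smear]

lemma IsTame.smear_pos (hν : IsTame ν) (hφ : HasQuadraticDecay φ) (hc : Continuous φ)
    (hν0 : ν ≠ 0) {t : ℝ} (hpos : ∀ᵐ x ∂ν, 0 < φ (t - x)) : 0 < smear φ ν t := by
  refine (integral_pos_iff_support_of_nonneg_ae (hpos.mono fun x hx => hx.le)
    (hν.integrable_comp_sub hφ hc t)).2 ?_
  have hsupport : Function.support (fun x => φ (t - x)) =ᵐ[ν] univ :=
    Filter.eventuallyEq_univ.2 (hpos.mono fun x hx => hx.ne')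
  rw [measure_congr hsupport, Measure.measure_univ_pos]
  exact hν0

lemma measurable_integral_measure {α : Type*} [MeasurableSpace α] {f : α → ℝ}
    (hf : Measurable f) : Measurable fun ν : Measure α => ∫ x, f x ∂ν := by
  have hint : MeasurableSet {ν : Measure α | Integrable f ν} := by
    simp only [Integrable, hf.aestronglyMeasurable, true_and]
    exact measurableSet_lt (Measure.measurable_lintegral hf.enorm) measurable_const
  have heq : (fun ν : Measure α => ∫ x, f x ∂ν) = {ν | Integrable f ν}.indicator fun ν =>
      (∫⁻ x, ENNReal.ofReal (f x) ∂ν).toReal - (∫⁻ x, ENNReal.ofReal (-f x) ∂ν).toReal := by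
    ext ν
    by_cases hν : Integrable f ν
    · rw [indicator_of_mem (s := {ν | Integrable f ν}) hν,
        integral_eq_lintegral_pos_part_sub_lintegral_neg_part hν]
    · rw [indicator_of_notMem (s := {ν | Integrable f ν}) hν, integral_undef hν]
  rw [heq]
  exact ((Measure.measurable_lintegral (by fun_prop)).ennreal_toReal.sub
    (Measure.measurable_lintegral (by fun_prop)).ennreal_toReal).indicator hint

lemma measurable_smear (hφ : Measurable φ) (t : ℝ) : Measurable fun ν => smear φ ν t :=
  measurable_integral_measure (by fun_prop)

end

/-! ### Laws of random measures -/

section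

variable {E : Type*} [MeasurableSpace E]

lemma instMeasurableSpace_measure_eq_comap :
    (Measure.instMeasurableSpace : MeasurableSpace (Measure E)) =
      MeasurableSpace.pi.comap fun ν (s : {s : Set E // MeasurableSet s}) => ν s := by
  rw [Measure.instMeasurableSpace, MeasurableSpace.pi, MeasurableSpace.comap_iSup, iSup_subtype]
  simp only [MeasurableSpace.comap_comp, Function.comp_def]
  rfl

lemma measure_ext_of_map_eval {M M' : Measure (Measure E)} [IsFiniteMeasure M]
    (h : ∀ J : Finset {s : Set E // MeasurableSet s},
      M.map (fun ν (s : J) => ν s.1) = M'.map fun ν (s : J) => ν s.1) : M = M' := by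
  set ev : Measure E → {s : Set E // MeasurableSet s} → ℝ≥0∞ := fun ν s => ν s with hev
  have hmeas : Measurable ev := measurable_pi_lambda _ fun s => Measure.measurable_coe s.2
  have : IsFiniteMeasure M' := by
    refine ⟨?_⟩
    have hmass : M univ = M' univ := by
      simpa [Measure.map_apply (measurable_pi_lambda _ _)] using congrArg (· univ) (h ∅)
    exact hmass ▸ measure_lt_top M univ
  have hmap : M.map ev = M'.map ev := by
    refine IsProjectiveLimit.unique (P := fun J => M.map fun ν (s : J) => ν s.1) (fun J => ?_)
      fun J => ?_
    · rw [Measure.map_map (Finset.measurable_restrict J) hmeas]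
      rfl
    · rw [Measure.map_map (Finset.measurable_restrict J) hmeas]
      exact (h J).symm
  ext S hS
  rw [instMeasurableSpace_measure_eq_comap] at hS
  obtain ⟨T, hT, rfl⟩ := hS
  rw [← hev, ← Measure.map_apply hmeas hT, ← Measure.map_apply hmeas hT, hmap]

end

/-! ### Poisson weights and size bias -/

lemma succ_mul_poissonMeasure_singleton (r : ℝ≥0) (n : ℕ) :
    ((n + 1 : ℕ) : ℝ≥0∞) * poissonMeasure r {n + 1} = r * poissonMeasure r {n} := by
  rw [poissonMeasure_singleton, poissonMeasure_singleton, ← ENNReal.ofReal_natCast,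
    ← ENNReal.ofReal_coe_nnreal, ← ENNReal.ofReal_mul (by positivity),
    ← ENNReal.ofReal_mul (by positivity), Nat.factorial_succ, pow_succ]
  congr 1
  have hfact : (n.factorial : ℝ) ≠ 0 := by positivity
  push_cast
  field_simp

lemma tsum_poissonMeasure_singleton (r : ℝ≥0) : ∑' n, poissonMeasure r {n} = 1 := by
  simpa using (lintegral_countable' (μ := poissonMeasure r) (fun _ => 1)).symm

lemma exp_mul_poissonMeasure_add_singleton_zero (w s : ℝ≥0) :
    ENNReal.ofReal (Real.exp s) * poissonMeasure (w + s) {0} = poissonMeasure w {0} := by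
  rw [poissonMeasure_singleton, poissonMeasure_singleton, ← ENNReal.ofReal_mul (Real.exp_nonneg _),
    ← mul_div_assoc, ← mul_assoc, ← Real.exp_add]
  push_cast
  ring_nf

lemma lintegral_natCast_mul_poissonMeasure (r : ℝ≥0) (f : ℕ → ℝ≥0∞) :
    ∫⁻ n, (n : ℝ≥0∞) * f n ∂poissonMeasure r = r * ∫⁻ n, f (n + 1) ∂poissonMeasure r := by
  rw [lintegral_countable', lintegral_countable', tsum_eq_zero_add' ENNReal.summable,
    ← ENNReal.tsum_mul_left]
  simp only [Nat.cast_zero, zero_mul, zero_add]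
  refine tsum_congr fun n => ?_
  rw [mul_right_comm, succ_mul_poissonMeasure_singleton, mul_assoc, mul_comm (f _)]

section

variable {Ω β : Type*} [MeasurableSpace Ω] [MeasurableSpace β] {μ : Measure Ω}

lemma lintegral_poisson_mul_of_indepFun [IsFiniteMeasure μ] {r : ℝ≥0} {X : Ω → ℝ≥0∞} {Y : Ω → β}
    (hX : HasLaw X ((poissonMeasure r).map (fun k : ℕ => (k : ℝ≥0∞))) μ) (hY : AEMeasurable Y μ)
    (hXY : IndepFun X Y μ) {F : ℝ≥0∞ × β → ℝ≥0∞} (hF : Measurable F) :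
    ∫⁻ ω, X ω * F (X ω, Y ω) ∂μ = r * ∫⁻ ω, F (X ω + 1, Y ω) ∂μ := by
  have hcast : Measurable fun k : ℕ => (k : ℝ≥0∞) := measurable_of_countable _
  have hlaw : ∀ G : ℝ≥0∞ × β → ℝ≥0∞, Measurable G → ∫⁻ ω, G (X ω, Y ω) ∂μ =
      ∫⁻ y, ∫⁻ k : ℕ, G (k, y) ∂poissonMeasure r ∂μ.map Y := fun G hG => by
    rw [← lintegral_map' hG.aemeasurable (hX.aemeasurable.prodMk hY),
      (indepFun_iff_map_prod_eq_prod_map_map hX.aemeasurable hY).1 hXY, hX.map_eq,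
      lintegral_prod_symm' _ hG]
    exact lintegral_congr fun y => lintegral_map (by fun_prop) hcast
  rw [hlaw (fun p => p.1 * F p) (by fun_prop), hlaw (fun p => F (p.1 + 1, p.2)) (by fun_prop),
    ← lintegral_const_mul']
  · refine lintegral_congr fun y => ?_
    rw [lintegral_natCast_mul_poissonMeasure r fun k => F (k, y)]
    simp only [Nat.cast_add, Nat.cast_one]
  · exact ENNReal.coe_ne_top

end

/-! ### Poisson random measures -/

/-- `N` is a Poisson random measure with intensity measure `Λ`. It is encoded as a measurable map
into the space of measures, so that functionals of the whole configuration can be integrated. -/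
structure IsPoissonMeasure {Ω E : Type*} [MeasurableSpace Ω] [MeasurableSpace E] (μ : Measure Ω)
    (Λ : Measure E) (N : Ω → Measure E) : Prop where
  measurable : Measurable N
  law_apply : ∀ B, MeasurableSet B → Λ B ≠ ∞ →
    HasLaw (fun ω => N ω B) ((poissonMeasure (Λ B).toNNReal).map (fun k : ℕ => (k : ℝ≥0∞))) μ
  indep_apply : ∀ (n : ℕ) (B : Fin n → Set E), (∀ j, MeasurableSet (B j)) →
    Pairwise (fun j k => Disjoint (B j) (B k)) → iIndepFun (fun j ω => N ω (B j)) μ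

/-- The atom of the finite algebra generated by the sets `s i` whose points lie in exactly those
`s i` with `i ∈ v`. -/
def atom {ι E : Type*} (s : ι → Set E) (v : Set ι) : Set E := {x | ∀ i, x ∈ s i ↔ i ∈ v}

section

variable {ι E : Type*}

lemma pairwise_disjoint_atom (s : ι → Set E) : Pairwise fun v w => Disjoint (atom s v) (atom s w) :=
  fun _ _ hvw => disjoint_left.2 fun _ hv hw => hvw (ext fun i => (hv i).symm.trans (hw i))

lemma iUnion_inter_atom (s : ι → Set E) (B : Set E) : ⋃ v, B ∩ atom s v = B := by
  refine Subset.antisymm (iUnion_subset fun v => inter_subset_left) fun x hx => ?_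
  exact mem_iUnion.2 ⟨{i | x ∈ s i}, hx, fun i => Iff.rfl⟩

lemma pairwise_disjoint_inter_atom (s : ι → Set E) (B : Set E) :
    Pairwise fun v w => Disjoint (B ∩ atom s v) (B ∩ atom s w) := fun _ _ hvw =>
  (pairwise_disjoint_atom s hvw).mono inter_subset_right inter_subset_right

variable [MeasurableSpace E] {s : ι → Set E}

lemma measurableSet_atom [Countable ι] (hs : ∀ i, MeasurableSet (s i)) (v : Set ι) :
    MeasurableSet (atom s v) := by
  rw [atom, ofPred_forall]
  exact .iInter fun i => (hs i).iff (.const _)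

variable [Fintype ι]

lemma measure_eq_sum_inter_atom (hs : ∀ i, MeasurableSet (s i)) {B : Set E}
    (hB : MeasurableSet B) (ν : Measure E) : ν B = ∑ v, ν (B ∩ atom s v) := by
  conv_lhs => rw [← iUnion_inter_atom s B]
  rw [measure_iUnion (pairwise_disjoint_inter_atom s B)
    fun v => hB.inter (measurableSet_atom hs v), tsum_fintype]

open scoped Classical in
lemma measure_eq_sum_atom (hs : ∀ i, MeasurableSet (s i)) (ν : Measure E) (i : ι) :
    ν (s i) = ∑ v, if i ∈ v then ν (atom s v) else 0 := by
  rw [measure_eq_sum_inter_atom hs (hs i)]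
  refine Finset.sum_congr rfl fun v _ => ?_
  split_ifs with hi
  · rw [inter_eq_right.2 fun x hx => (hx i).2 hi]
  · rw [disjoint_iff_inter_eq_empty.1 (disjoint_left.2 fun x hx hv => hi ((hv i).1 hx)),
      measure_empty]

end

namespace IsPoissonMeasure

variable {Ω E : Type*} [MeasurableSpace Ω] [MeasurableSpace E] {μ : Measure Ω} {Λ : Measure E}
  {N : Ω → Measure E}

section

variable (hN : IsPoissonMeasure μ Λ N)
include hN

lemma measurable_apply {B : Set E} (hB : MeasurableSet B) : Measurable fun ω => N ω B :=
  (Measure.measurable_coe hB).comp hN.measurable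

lemma measurable_add_dirac : Measurable fun p : E × Ω => N p.2 + Measure.dirac p.1 :=
  (hN.measurable.comp measurable_snd).add (Measure.measurable_dirac.comp measurable_fst)

lemma iIndepFun_apply {κ : Type*} [Finite κ] {B : κ → Set E} (hB : ∀ k, MeasurableSet (B k))
    (hdis : Pairwise fun j k => Disjoint (B j) (B k)) : iIndepFun (fun k ω => N ω (B k)) μ := by
  have e := Finite.equivFin κ
  simpa using (hN.indep_apply _ (fun j => B (e.symm j)) (fun j => hB _)
    fun j k hjk => hdis (e.symm.injective.ne hjk)).precomp e.injective

-- Both sides are functions of the counts of the disjoint sets `C` and `atom s v`.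
lemma indepFun_apply_of_disjoint {ι : Type*} [Finite ι] {C : Set E} (hC : MeasurableSet C)
    {s : ι → Set E} (hs : ∀ i, MeasurableSet (s i)) (hsC : ∀ i, Disjoint (s i) C) :
    IndepFun (fun ω => N ω C) (fun ω i => N ω (s i)) μ := by
  classical
  have := Fintype.ofFinite ι
  let B : Option (Set ι) → Set E := fun o => o.elim C fun v => atom s v \ C
  have hB : ∀ o, MeasurableSet (B o) := Option.forall.2
    ⟨hC, fun v => (measurableSet_atom hs v).diff hC⟩
  have hdis : Pairwise fun o o' => Disjoint (B o) (B o') := by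
    rintro (_ | v) (_ | w) hvw
    · exact absurd rfl hvw
    · exact disjoint_sdiff_right
    · exact disjoint_sdiff_left
    · exact (pairwise_disjoint_atom s fun h => hvw (congrArg some h)).mono sdiff_subset sdiff_subset
  have hind := (hN.iIndepFun_apply hB hdis).indepFun_finset {none} (Finset.univ.image some)
    (by simp) fun o => hN.measurable_apply (hB o)
  have hsum : ∀ ω i, N ω (s i) = ∑ v, if i ∈ v then N ω (B (some v)) else 0 := fun ω i => by
    have hrestrict : ∀ t, MeasurableSet t → (N ω).restrict Cᶜ t = N ω (t \ C) := fun t ht =>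
      Measure.restrict_apply ht
    rw [← (hsC i).sdiff_eq_left, ← hrestrict _ (hs i), measure_eq_sum_atom hs]
    simp only [hrestrict _ (measurableSet_atom hs _), B, Option.elim_some]
  let φ : (({none} : Finset (Option (Set ι))) → ℝ≥0∞) → ℝ≥0∞ := fun y => y ⟨none, by simp⟩
  let ψ : (Finset.univ.image (some : Set ι → Option (Set ι)) → ℝ≥0∞) → ι → ℝ≥0∞ :=
    fun y i => ∑ v, if i ∈ v then y ⟨some v, by simp⟩ else 0
  have hφ : Measurable φ := measurable_pi_apply _
  have hψ : Measurable ψ := measurable_pi_lambda _ fun i =>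
    Finset.measurable_fun_sum _ fun v _ =>
      Measurable.ite (.const _) (measurable_pi_apply _) measurable_const
  simp only [hsum]
  exact hind.comp hφ hψ

end

section Mecke

variable [IsFiniteMeasure μ] (hN : IsPoissonMeasure μ Λ N)
include hN

lemma lintegral_apply_mul_of_subset_atom {ι : Type*} [Finite ι] {s : ι → Set E}
    (hs : ∀ i, MeasurableSet (s i)) {v : Set ι} {C : Set E} (hC : MeasurableSet C)
    (hΛC : Λ C ≠ ∞) (hCv : C ⊆ atom s v) {f : (ι → ℝ≥0∞) → ℝ≥0∞} (hf : Measurable f) :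
    ∫⁻ ω, N ω C * f (fun i => N ω (s i)) ∂μ =
      ∫⁻ x in C, ∫⁻ ω, f (fun i => (N ω + Measure.dirac x) (s i)) ∂μ ∂Λ := by
  classical
  have hsplit : ∀ ω i, N ω (s i) = N ω (s i \ C) + if i ∈ v then N ω C else 0 := fun ω i => by
    rw [← measure_inter_add_sdiff (s i) hC, add_comm]
    split_ifs with hi
    · rw [inter_eq_right.2 fun x hx => (hCv hx i).2 hi]
    · rw [disjoint_iff_inter_eq_empty.1 (disjoint_left.2 fun x hx hxC => hi ((hCv hxC i).1 hx)),
        measure_empty]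
  have hadd : ∀ x ∈ C, ∀ ω i, (N ω + Measure.dirac x) (s i) =
      N ω (s i \ C) + if i ∈ v then N ω C + 1 else 0 := fun x hx ω i => by
    rw [Measure.add_apply, hsplit, Measure.dirac_apply' _ (hs i), indicator_apply, Pi.one_apply,
      add_assoc]
    simp only [hCv hx i]
    split_ifs <;> simp only [add_zero]
  have hsC : ∀ i, MeasurableSet (s i \ C) := fun i => (hs i).diff hC
  have hG : Measurable fun p : ℝ≥0∞ × (ι → ℝ≥0∞) =>
      f (fun i => p.2 i + if i ∈ v then p.1 else 0) :=
    hf.comp (measurable_pi_lambda _ fun i => ((measurable_pi_apply i).comp measurable_snd).add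
      (Measurable.ite (.const _) measurable_fst measurable_const))
  rw [setLIntegral_congr_fun hC fun x hx => lintegral_congr fun ω =>
    congrArg f (funext (hadd x hx ω)), setLIntegral_const, mul_comm _ (Λ C)]
  simp only [hsplit]
  rw [lintegral_poisson_mul_of_indepFun (hN.law_apply C hC hΛC)
    (measurable_pi_lambda _ fun i => hN.measurable_apply (hsC i)).aemeasurable
    (hN.indepFun_apply_of_disjoint hC hsC fun i => disjoint_sdiff_left) hG,
    ENNReal.coe_toNNReal hΛC]

lemma lintegral_apply_mul_eval {ι : Type*} [Finite ι] {s : ι → Set E}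
    (hs : ∀ i, MeasurableSet (s i)) {B : Set E} (hB : MeasurableSet B) (hΛB : Λ B ≠ ∞)
    {f : (ι → ℝ≥0∞) → ℝ≥0∞} (hf : Measurable f) :
    ∫⁻ ω, N ω B * f (fun i => N ω (s i)) ∂μ =
      ∫⁻ x in B, ∫⁻ ω, f (fun i => (N ω + Measure.dirac x) (s i)) ∂μ ∂Λ := by
  have := Fintype.ofFinite ι
  have hBv : ∀ v, MeasurableSet (B ∩ atom s v) := fun v => hB.inter (measurableSet_atom hs v)
  have hmeas : ∀ v, Measurable fun ω => N ω (B ∩ atom s v) * f (fun i => N ω (s i)) := fun v =>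
    (hN.measurable_apply (hBv v)).mul
      (hf.comp (measurable_pi_lambda _ fun i => hN.measurable_apply (hs i)))
  calc ∫⁻ ω, N ω B * f (fun i => N ω (s i)) ∂μ
      = ∫⁻ ω, ∑ v, N ω (B ∩ atom s v) * f (fun i => N ω (s i)) ∂μ := by
        simp only [measure_eq_sum_inter_atom hs hB, Finset.sum_mul]
    _ = ∑ v, ∫⁻ x in B ∩ atom s v, ∫⁻ ω, f (fun i => (N ω + Measure.dirac x) (s i)) ∂μ ∂Λ := by
        rw [lintegral_finsetSum _ fun v _ => hmeas v]
        exact Finset.sum_congr rfl fun v _ => hN.lintegral_apply_mul_of_subset_atom hs (hBv v)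
          (measure_ne_top_of_subset inter_subset_left hΛB) inter_subset_right hf
    _ = _ := by
        conv_rhs => rw [← iUnion_inter_atom s B]
        rw [lintegral_iUnion hBv (pairwise_disjoint_inter_atom s B), tsum_fintype]

theorem mecke_formula {B : Set E} (hB : MeasurableSet B) (hΛB : Λ B ≠ ∞)
    {F : Measure E → ℝ≥0∞} (hF : Measurable F) :
    ∫⁻ ω, N ω B * F (N ω) ∂μ = ∫⁻ x in B, ∫⁻ ω, F (N ω + Measure.dirac x) ∂μ ∂Λ := by
  have : IsFiniteMeasure (Λ.restrict B) := isFiniteMeasure_restrict.2 hΛB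
  have hNB : Measurable fun ω => N ω B := hN.measurable_apply hB
  have hsize : ∀ G : Measure E → ℝ≥0∞, Measurable G →
      ∫⁻ ν, G ν ∂(μ.withDensity fun ω => N ω B).map N = ∫⁻ ω, N ω B * G (N ω) ∂μ := fun G hG => by
    rw [lintegral_map hG hN.measurable]
    exact lintegral_withDensity_eq_lintegral_mul _ hNB (hG.comp hN.measurable)
  have hshift : ∀ G : Measure E → ℝ≥0∞, Measurable G →
      ∫⁻ ν, G ν ∂((Λ.restrict B).prod μ).map (fun p => N p.2 + Measure.dirac p.1) =
        ∫⁻ x in B, ∫⁻ ω, G (N ω + Measure.dirac x) ∂μ ∂Λ := fun G hG => by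
    rw [lintegral_map hG hN.measurable_add_dirac]
    exact lintegral_prod _ (hG.comp hN.measurable_add_dirac).aemeasurable
  rw [← hsize F hF, ← hshift F hF]
  congr 1
  refine (measure_ext_of_map_eval fun J => Measure.ext_of_lintegral _ fun f hf => ?_).symm
  have heval : Measurable fun (ν : Measure E) (s : J) => ν s.1 :=
    measurable_pi_lambda _ fun s => Measure.measurable_coe s.1.2
  rw [lintegral_map hf heval, lintegral_map hf heval]
  exact (hshift _ (hf.comp heval)).trans
    ((hN.lintegral_apply_mul_eval (fun s : J => s.1.2) hB hΛB hf).symm.trans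
      (hsize _ (hf.comp heval)).symm)

end Mecke

end IsPoissonMeasure

namespace IsPoissonMeasure

variable {Ω E : Type*} [MeasurableSpace Ω] [MeasurableSpace E] {μ : Measure Ω} {Λ : Measure E}
  {N : Ω → Measure E}

section

variable (hN : IsPoissonMeasure μ Λ N)
include hN

lemma ae_exists_natCast {B : Set E} (hB : MeasurableSet B) (hΛB : Λ B ≠ ∞) :
    ∀ᵐ ω ∂μ, ∃ k : ℕ, N ω B = k := by
  have hcast : Measurable fun k : ℕ => (k : ℝ≥0∞) := measurable_of_countable _
  have hrange : MeasurableSet {x : ℝ≥0∞ | ∃ k : ℕ, x = k} := by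
    convert (countable_range fun k : ℕ => (k : ℝ≥0∞)).measurableSet using 1
    ext x
    simp only [mem_range, eq_comm, mem_ofPred_eq]
  rw [(hN.law_apply B hB hΛB).ae_iff (p := fun x => ∃ k : ℕ, x = k)
    (measurableSet_setOfPred.1 hrange), ae_map_iff hcast.aemeasurable hrange]
  exact .of_forall fun k => ⟨k, rfl⟩

lemma measure_apply_eq_natCast {B : Set E} (hB : MeasurableSet B) (hΛB : Λ B ≠ ∞) (n : ℕ) :
    μ {ω | N ω B = n} = poissonMeasure (Λ B).toNNReal {n} := by
  have hcast : Measurable fun k : ℕ => (k : ℝ≥0∞) := measurable_of_countable _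
  have hpre : (fun k : ℕ => (k : ℝ≥0∞)) ⁻¹' {(n : ℝ≥0∞)} = {n} := by
    ext k
    simp only [mem_preimage, mem_singleton_iff, Nat.cast_inj]
  rw [(hN.law_apply B hB hΛB).measure_eq (p := (· = (n : ℝ≥0∞))) (measurableSet_singleton _)]
  change Measure.map _ _ {(n : ℝ≥0∞)} = _
  rw [Measure.map_apply hcast (measurableSet_singleton _), hpre]

lemma ae_ne_zero [SigmaFinite Λ] (hΛ : Λ univ = ∞) : ∀ᵐ ω ∂μ, N ω ≠ 0 := by
  have hle : ∀ n, μ {ω | N ω = 0} ≤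
      ENNReal.ofReal (Real.exp (-(Λ (spanningSets Λ n)).toReal)) := fun n => by
    refine (measure_mono fun ω (hω : N ω = 0) => ?_).trans
      ((hN.measure_apply_eq_natCast (measurableSet_spanningSets Λ n)
        (measure_spanningSets_lt_top Λ n).ne 0).trans_le ?_)
    · simp [hω]
    · simp [poissonMeasure_singleton, ENNReal.toReal]
  have hgrow : Filter.Tendsto (fun n => (Λ (spanningSets Λ n)).toReal) .atTop .atTop := by
    have h := tendsto_measure_iUnion_atTop (μ := Λ) (monotone_spanningSets Λ)
    rw [iUnion_spanningSets, hΛ] at h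
    refine ENNReal.tendsto_ofReal_nhds_top.1 (h.congr fun n => ?_)
    exact (ENNReal.ofReal_toReal (measure_spanningSets_lt_top Λ n).ne).symm
  have hlim := ENNReal.tendsto_ofReal
    (Real.tendsto_exp_atBot.comp (Filter.tendsto_neg_atTop_atBot.comp hgrow))
  rw [ENNReal.ofReal_zero] at hlim
  simpa [ae_iff] using ge_of_tendsto' hlim hle

lemma ae_notMem_of_add_dirac [IsFiniteMeasure μ] [SigmaFinite Λ] (h0 : ∀ᵐ ω ∂μ, N ω ≠ 0)
    {S : Set (Measure E)} (hS : MeasurableSet S)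
    (h : ∀ᵐ ω ∂μ, ∀ᵐ x ∂Λ, N ω + Measure.dirac x ∉ S) : ∀ᵐ ω ∂μ, N ω ∉ S := by
  have hF : Measurable (S.indicator (1 : Measure E → ℝ≥0∞)) := measurable_one.indicator hS
  have hzero : ∀ n, ∫⁻ ω, N ω (spanningSets Λ n) * S.indicator 1 (N ω) ∂μ = 0 := fun n => by
    rw [hN.mecke_formula (measurableSet_spanningSets Λ n)
      (measure_spanningSets_lt_top Λ n).ne hF, lintegral_lintegral_swap
        (f := fun x ω => S.indicator 1 (N ω + Measure.dirac x))
        (hF.comp hN.measurable_add_dirac).aemeasurable]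
    refine (lintegral_congr_ae (h.mono fun ω hω => ?_)).trans lintegral_zero
    refine (lintegral_congr_ae ((ae_restrict_of_ae hω).mono fun x hx => ?_)).trans lintegral_zero
    exact indicator_of_notMem hx _
  have hmul : ∀ᵐ ω ∂μ, ∀ n, N ω (spanningSets Λ n) * S.indicator 1 (N ω) = 0 :=
    ae_all_iff.2 fun n => (lintegral_eq_zero_iff ((hN.measurable_apply
      (measurableSet_spanningSets Λ n)).mul (hF.comp hN.measurable))).1 (hzero n)
  filter_upwards [h0, hmul] with ω hω hmul hmem
  refine hω (Measure.measure_univ_eq_zero.1 ?_)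
  rw [← iUnion_spanningSets Λ, measure_iUnion_null_iff]
  simpa [hmem] using hmul

lemma join_map_eq [IsProbabilityMeasure μ] [SigmaFinite Λ] : (μ.map N).join = Λ := by
  refine (Measure.ext_iff_of_iUnion_eq_univ (iUnion_spanningSets Λ)).2 fun n => ?_
  ext A hA
  have hAn := hA.inter (measurableSet_spanningSets Λ n)
  rw [Measure.restrict_apply hA, Measure.restrict_apply hA, Measure.join_apply hAn,
    lintegral_map (Measure.measurable_coe hAn) hN.measurable]
  have hΛ := ((measure_mono (inter_subset_right (s := A))).trans_lt
    (measure_spanningSets_lt_top Λ n)).ne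
  simpa using hN.mecke_formula hAn hΛ (F := fun _ => 1) measurable_const

theorem campbell_formula [IsProbabilityMeasure μ] [SigmaFinite Λ] {h : E → ℝ≥0∞}
    (hh : Measurable h) : ∫⁻ ω, ∫⁻ x, h x ∂N ω ∂μ = ∫⁻ x, h x ∂Λ := by
  conv_rhs => rw [← hN.join_map_eq]
  rw [Measure.lintegral_join hh.aemeasurable,
    lintegral_map (Measure.measurable_lintegral hh) hN.measurable]

end

section

variable {Ω' : Type*} [MeasurableSpace Ω'] {μ' : Measure Ω'} {N' : Ω' → Measure E}

lemma map_apply_Iic_eq_iInf [IsFiniteMeasure μ] [SigmaFinite Λ] (hN : IsPoissonMeasure μ Λ N)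
    {A : Set E} (hA : MeasurableSet A) (a : ℝ≥0∞) : μ.map (fun ω => N ω A) (Iic a) =
      ⨅ n, μ.map (fun ω => N ω (A ∩ spanningSets Λ n)) (Iic a) := by
  have hAn : ∀ n, MeasurableSet (A ∩ spanningSets Λ n) := fun n =>
    hA.inter (measurableSet_spanningSets Λ n)
  have hmono : Monotone fun n => A ∩ spanningSets Λ n := fun m n h =>
    inter_subset_inter_right A (monotone_spanningSets Λ h)
  have hset : (fun ω => N ω A) ⁻¹' Iic a =
      ⋂ n, (fun ω => N ω (A ∩ spanningSets Λ n)) ⁻¹' Iic a := by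
    ext ω
    have hA' : N ω A = ⨆ n, N ω (A ∩ spanningSets Λ n) := by
      rw [← hmono.measure_iUnion, ← inter_iUnion, iUnion_spanningSets, inter_univ]
    simp only [mem_preimage, mem_Iic, mem_iInter, hA', iSup_le_iff]
  simp only [Measure.map_apply (hN.measurable_apply hA) measurableSet_Iic,
    Measure.map_apply (hN.measurable_apply (hAn _)) measurableSet_Iic, hset]
  refine Antitone.measure_iInter (fun m n h ω hω => ?_) (fun n =>
    (hN.measurable_apply (hAn n) measurableSet_Iic).nullMeasurableSet) ⟨0, measure_ne_top _ _⟩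
  exact (measure_mono (hmono h)).trans hω

lemma map_apply_eq [IsFiniteMeasure μ] [IsFiniteMeasure μ'] [SigmaFinite Λ]
    (hN : IsPoissonMeasure μ Λ N) (hN' : IsPoissonMeasure μ' Λ N') {A : Set E}
    (hA : MeasurableSet A) : μ.map (fun ω => N ω A) = μ'.map fun ω => N' ω A := by
  refine Measure.ext_of_Iic _ _ fun a => ?_
  rw [hN.map_apply_Iic_eq_iInf hA, hN'.map_apply_Iic_eq_iInf hA]
  refine iInf_congr fun n => ?_
  have hAn := hA.inter (measurableSet_spanningSets Λ n)
  have hfin : Λ (A ∩ spanningSets Λ n) ≠ ∞ :=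
    ((measure_mono inter_subset_right).trans_lt (measure_spanningSets_lt_top Λ n)).ne
  rw [(hN.law_apply _ hAn hfin).map_eq, (hN'.law_apply _ hAn hfin).map_eq]

open scoped Classical in
lemma map_map_eval_eq [IsProbabilityMeasure μ] (hN : IsPoissonMeasure μ Λ N) {ι : Type*}
    [Fintype ι] {s : ι → Set E} (hs : ∀ i, MeasurableSet (s i)) :
    (μ.map N).map (fun ν i => ν (s i)) =
      (Measure.pi fun v => μ.map fun ω => N ω (atom s v)).map
        fun y i => ∑ v, if i ∈ v then y v else 0 := by
  have hNa : ∀ v, Measurable fun ω => N ω (atom s v) := fun v =>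
    hN.measurable_apply (measurableSet_atom hs v)
  have hψ : Measurable fun (y : Set ι → ℝ≥0∞) i => ∑ v, if i ∈ v then y v else 0 :=
    measurable_pi_lambda _ fun i => Finset.measurable_fun_sum _ fun v _ =>
      Measurable.ite (.const _) (measurable_pi_apply _) measurable_const
  rw [← (iIndepFun_iff_map_fun_eq_pi_map fun v => (hNa v).aemeasurable).1
    (hN.iIndepFun_apply (measurableSet_atom hs) (pairwise_disjoint_atom s)),
    Measure.map_map hψ (measurable_pi_lambda _ hNa), Measure.map_map
      (measurable_pi_lambda _ fun i => Measure.measurable_coe (hs i)) hN.measurable]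
  exact congrArg μ.map (funext fun ω => funext fun i => measure_eq_sum_atom hs (N ω) i)

theorem map_eq [IsProbabilityMeasure μ] [IsProbabilityMeasure μ'] [SigmaFinite Λ]
    (hN : IsPoissonMeasure μ Λ N) (hN' : IsPoissonMeasure μ' Λ N') : μ.map N = μ'.map N' := by
  refine measure_ext_of_map_eval fun J => ?_
  have hs : ∀ i : J, MeasurableSet (i.1 : Set E) := fun i => i.1.2
  rw [hN.map_map_eval_eq hs, hN'.map_map_eval_eq hs]
  simp only [hN.map_apply_eq hN' (measurableSet_atom hs _)]

end

protected lemma map {F : Type*} [MeasurableSpace F] (hN : IsPoissonMeasure μ Λ N) {f : E → F}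
    (hf : Measurable f) : IsPoissonMeasure μ (Λ.map f) fun ω => (N ω).map f where
  measurable := (Measure.measurable_map f hf).comp hN.measurable
  law_apply B hB hΛB := by
    rw [Measure.map_apply hf hB] at hΛB ⊢
    simpa only [Measure.map_apply hf hB] using hN.law_apply _ (hf hB) hΛB
  indep_apply n B hB hdis := by
    simpa only [Measure.map_apply hf (hB _)] using
      hN.indep_apply n (fun j => f ⁻¹' B j) (fun j => hf (hB j))
        fun j k h => (hdis h).preimage f

end IsPoissonMeasure

/-! ### The counting measure of the points -/

section

variable {Ω : Type*} {τ : ℕ → Ω → ℝ} {σ : ℝ}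

/-- The counting measure of the points `τ i ω`. -/
def pointMeasure (τ : ℕ → Ω → ℝ) (ω : Ω) : Measure ℝ := .sum fun i => .dirac (τ i ω)

lemma pointMeasure_apply {B : Set ℝ} (hB : MeasurableSet B) (ω : Ω) :
    pointMeasure τ ω B = pointCount τ B ω := by
  rw [pointMeasure, Measure.sum_apply _ hB, pointCount, ← ENNReal.tsum_set_one]
  refine Eq.trans ?_ (tsum_subtype {i | τ i ω ∈ B} fun _ => 1).symm
  exact tsum_congr fun i => Measure.dirac_apply' _ hB

lemma shotNoise_eq_smear (hσ : 0 < σ) {ω : Ω} (hω : IsTame (pointMeasure τ ω)) :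
    shotNoise σ τ ω = smear (gaussianKernel σ) (pointMeasure τ ω) := by
  ext t
  have hint := hω.integrable_comp_sub (hasQuadraticDecay_gaussianKernel hσ)
    (continuous_gaussianKernel σ) t
  rw [shotNoise, smear, pointMeasure, integral_sum_measure hint]
  simp only [integral_dirac]

lemma summable_gaussianKernel (hσ : 0 < σ) {ω : Ω} (hω : IsTame (pointMeasure τ ω)) (t : ℝ) :
    Summable fun i => gaussianKernel σ (t - τ i ω) := by
  have hint := hω.integrable_comp_sub (hasQuadraticDecay_gaussianKernel hσ)
    (continuous_gaussianKernel σ) t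
  simpa only [integral_dirac] using (hasSum_integral_measure hint).summable

variable [MeasurableSpace Ω] {μ : Measure Ω} {lam : ℝ}

theorem IsPoissonProcess.isPoissonMeasure (hlam : 0 < lam) (hτ : IsPoissonProcess μ lam τ) :
    IsPoissonMeasure μ (lam.toNNReal • volume) (pointMeasure τ) where
  measurable := Measure.measurable_of_measurable_coe _ fun B hB => by
    simp only [pointMeasure, Measure.sum_apply _ hB, Measure.dirac_apply' _ hB]
    exact Measurable.tsum fun i =>
      (measurable_one.indicator hB).comp (hτ.measurable_point i)
  law_apply B hB hΛB := by
    have hΛ : (lam.toNNReal • volume) B = lam.toNNReal * volume B := rfl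
    have hvol : volume B ≠ ∞ := fun h => hΛB <| by
      rw [hΛ, h, ENNReal.mul_top (by simpa using hlam)]
    have hrate : ((lam.toNNReal • volume) B).toNNReal = (lam * volume.real B).toNNReal := by
      rw [hΛ, ENNReal.toNNReal_mul, ENNReal.toNNReal_coe, Real.toNNReal_mul hlam.le]
      simp [Measure.real, ENNReal.toReal]
    have hlaw := hτ.law_count B hB hvol
    have hcast : HasLaw (fun k : ℕ∞ => (k : ℝ≥0∞))
        ((poissonMeasure (lam * volume.real B).toNNReal).map fun k : ℕ => (k : ℝ≥0∞))
        ((poissonMeasure (lam * volume.real B).toNNReal).map fun k : ℕ => (k : ℕ∞)) :=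
      ⟨measurable_from_top.aemeasurable, by
        rw [Measure.map_map measurable_from_top (measurable_of_countable _)]
        rfl⟩
    rw [hrate]
    simpa only [pointMeasure_apply hB] using hcast.fun_comp hlaw
  indep_apply n B hB hdis := by
    simp only [pointMeasure_apply (hB _)]
    exact (hτ.indep_count n B hB hdis).comp (fun _ k => (k : ℝ≥0∞)) fun _ => measurable_from_top

end

/-! ### Paths driven by a tame measure -/

section

variable {σ : ℝ} {ν : Measure ℝ}

lemma IsTame.hasDerivAt_smear_gaussianKernel (hσ : 0 < σ) (hν : IsTame ν) (t : ℝ) :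
    HasDerivAt (smear (gaussianKernel σ) ν) (smear (gaussianKernelDeriv σ) ν t) t :=
  hν.hasDerivAt_smear (hasQuadraticDecay_gaussianKernel hσ)
    (hasQuadraticDecay_gaussianKernelDeriv hσ) (continuous_gaussianKernelDeriv σ)
    (fun u => (hasStrictDerivAt_gaussianKernel σ u).hasDerivAt) t

lemma IsTame.hasDerivAt_smear_gaussianKernelDeriv (hσ : 0 < σ) (hν : IsTame ν) (t : ℝ) :
    HasDerivAt (smear (gaussianKernelDeriv σ) ν) (smear (gaussianKernelDerivTwo σ) ν t) t :=
  hν.hasDerivAt_smear (hasQuadraticDecay_gaussianKernelDeriv hσ)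
    (hasQuadraticDecay_gaussianKernelDerivTwo hσ) (continuous_gaussianKernelDerivTwo σ)
    (fun u => (hasStrictDerivAt_gaussianKernelDeriv σ u).hasDerivAt) t

lemma IsTame.deriv_smear_gaussianKernel (hσ : 0 < σ) (hν : IsTame ν) :
    deriv (smear (gaussianKernel σ) ν) = smear (gaussianKernelDeriv σ) ν :=
  funext fun t => (hν.hasDerivAt_smear_gaussianKernel hσ t).deriv

lemma IsTame.deriv_smear_gaussianKernelDeriv (hσ : 0 < σ) (hν : IsTame ν) :
    deriv (smear (gaussianKernelDeriv σ) ν) = smear (gaussianKernelDerivTwo σ) ν :=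
  funext fun t => (hν.hasDerivAt_smear_gaussianKernelDeriv hσ t).deriv

lemma IsTame.continuous_smear_gaussianKernelDeriv (hσ : 0 < σ) (hν : IsTame ν) :
    Continuous (smear (gaussianKernelDeriv σ) ν) :=
  hν.continuous_smear (hasQuadraticDecay_gaussianKernelDeriv hσ) (continuous_gaussianKernelDeriv σ)

lemma IsTame.continuous_smear_gaussianKernelDerivTwo (hσ : 0 < σ) (hν : IsTame ν) :
    Continuous (smear (gaussianKernelDerivTwo σ) ν) :=
  hν.continuous_smear (hasQuadraticDecay_gaussianKernelDerivTwo hσ)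
    (continuous_gaussianKernelDerivTwo σ)

lemma IsTame.contDiff_smear_gaussianKernel (hσ : 0 < σ) (hν : IsTame ν) :
    ContDiff ℝ 2 (smear (gaussianKernel σ) ν) := by
  rw [show (2 : WithTop ℕ∞) = 1 + 1 from one_add_one_eq_two.symm, contDiff_succ_iff_deriv,
    hν.deriv_smear_gaussianKernel hσ, contDiff_one_iff_deriv, hν.deriv_smear_gaussianKernelDeriv hσ]
  exact ⟨fun t => (hν.hasDerivAt_smear_gaussianKernel hσ t).differentiableAt, by simp,
    fun t => (hν.hasDerivAt_smear_gaussianKernelDeriv hσ t).differentiableAt,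
    hν.continuous_smear_gaussianKernelDerivTwo hσ⟩

end

namespace IsPoissonMeasure

variable {Ω : Type*} [MeasurableSpace Ω] {μ : Measure Ω} [IsProbabilityMeasure μ] {c : ℝ≥0}
  {N : Ω → Measure ℝ}

lemma ae_isTame (hN : IsPoissonMeasure μ (c • volume) N) : ∀ᵐ ω ∂μ, IsTame (N ω) := by
  have hh : Measurable fun x : ℝ => ENNReal.ofReal (1 + x ^ 2)⁻¹ := by fun_prop
  refine ae_lt_top ((Measure.measurable_lintegral hh).comp hN.measurable) ?_
  have hfin : ∫⁻ x : ℝ, ENNReal.ofReal (1 + x ^ 2)⁻¹ ≠ ∞ :=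
    (lintegral_ofReal_ne_top_iff_integrable (by fun_prop)
      (.of_forall fun x => by positivity)).2 integrable_inv_one_add_sq
  exact (hN.campbell_formula hh).trans_ne (by
    rw [lintegral_smul_measure]
    exact ENNReal.mul_ne_top ENNReal.coe_ne_top hfin)

lemma map_translate_eq (hN : IsPoissonMeasure μ (c • volume) N) (s : ℝ) :
    μ.map (fun ω => (N ω).map (· - s)) = μ.map N := by
  have h := hN.map (f := (· - s)) (by fun_prop)
  rw [Measure.map_smul, (measurePreserving_sub_right volume s).map_eq] at h
  exact h.map_eq hN

end IsPoissonMeasure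

lemma smear_map_sub {φ : ℝ → ℝ} (hφ : Measurable φ) (ν : Measure ℝ) (s t : ℝ) :
    smear φ (ν.map (· - s)) t = smear φ ν (t + s) := by
  rw [smear, integral_map (by fun_prop)
    (show Measurable fun x => φ (t - x) by fun_prop).aestronglyMeasurable, smear]
  exact integral_congr_ae (.of_forall fun x => by ring_nf)

/-! ### Mean crossings of Poisson sums -/

/-- The number of crossings of the level `c` in `[a, b]` by the path with kernel `φ` driven by `ν`,
on the event that `ν` is tame and gives the window `W` mass `n`; zero off that event. -/
def windowCrossings (φ : ℝ → ℝ) (W : Set ℝ) (a b : ℝ) (n : ℕ) (c : ℝ) (ν : Measure ℝ) : ℝ≥0∞ :=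
  {ν | IsTame ν ∧ ν W = n}.indicator (fun ν => (crossingCount (smear φ ν) c a b : ℝ≥0∞)) ν

section

variable {φ : ℝ → ℝ} {W : Set ℝ} {ι : Type*} {B : ι → Set ℝ} {a b : ℝ}

lemma windowCrossings_of_isTame {ν : Measure ℝ} (hν : IsTame ν) (n : ℕ) (c : ℝ) :
    windowCrossings φ W a b n c ν =
      {ν : Measure ℝ | ν W = n}.indicator
        (fun ν => (crossingCount (smear φ ν) c a b : ℝ≥0∞)) ν := by
  classical
  simp only [windowCrossings, indicator_apply, mem_ofPred_eq, hν, true_and]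

lemma measurable_windowCrossings (hφ : HasQuadraticDecay φ) (hc : Continuous φ)
    (hW : MeasurableSet W) (n : ℕ) :
    Measurable fun p : Measure ℝ × ℝ => windowCrossings φ W a b n p.2 p.1 := by
  have hS : MeasurableSet {p : Measure ℝ × ℝ | IsTame p.1 ∧ p.1 W = n} :=
    measurable_fst (measurableSet_isTame.inter
      (Measure.measurable_coe hW (measurableSet_singleton _)))
  have hcross : ∀ p : Measure ℝ × ℝ, crossingCount (smear φ p.1) p.2 a b =
      crossingCount (fun t => smear φ p.1 t + -p.2) 0 a b := fun p => by
    rw [crossingCount_add_const, zero_sub, neg_neg]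
  have h := measurable_indicator_crossingCount hS (Z := fun p t => smear φ p.1 t + -p.2)
    (fun p hp => (hp.1.continuous_smear hφ hc).add continuous_const)
    (fun t => ((measurable_smear hc.measurable t).comp measurable_fst).add measurable_snd.neg) 0 a b
  simp only [← hcross] at h
  exact h

lemma windowCrossings_succ_add_dirac (hφ : HasQuadraticDecay φ) (hc : Continuous φ)
    {ν : Measure ℝ} (hν : IsTame ν) (n : ℕ) (c : ℝ) {x : ℝ} (hx : x ∈ W) :
    windowCrossings φ W a b (n + 1) c (ν + Measure.dirac x) =
      {ν : Measure ℝ | ν W = n}.indicator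
        (fun ν => (crossingCount (fun t => smear φ ν t + φ (t - x)) c a b : ℝ≥0∞)) ν := by
  have hmass : (ν + Measure.dirac x) W = (n + 1 : ℕ) ↔ ν W = n := by
    rw [Measure.add_apply, Measure.dirac_apply_of_mem hx, Nat.cast_succ]
    exact ENNReal.add_left_inj ENNReal.one_ne_top
  have hsmear : smear φ (ν + Measure.dirac x) = fun t => smear φ ν t + φ (t - x) :=
    funext (hν.smear_add_dirac hφ hc x)
  classical
  simp only [windowCrossings_of_isTame (hν.add_dirac x), indicator_apply, mem_ofPred_eq, hmass,
    hsmear]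

lemma lintegral_windowCrossings_add_dirac_le [Fintype ι] (hφ : HasQuadraticDecay φ)
    (hc : Continuous φ) (hB : ∀ i, (B i).OrdConnected)
    (hdis : Pairwise fun i j => Disjoint (B i) (B j))
    (hmono : ∀ i, MonotoneOn φ (B i) ∨ AntitoneOn φ (B i)) (hW : MeasurableSet W)
    (hWB : ∀ x ∈ W, ∀ t ∈ Icc a b, t - x ∈ ⋃ i, B i) {ν : Measure ℝ} (hν : IsTame ν) (n : ℕ)
    (c : ℝ) :
    ∫⁻ x in W, windowCrossings φ W a b (n + 1) c (ν + Measure.dirac x) ≤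
      {ν : Measure ℝ | ν W = n}.indicator
        (fun _ => Fintype.card ι * ENNReal.ofReal (b - a)) ν +
      ∫⁻ u in ⋃ i, B i, windowCrossings φ W a b n (c - φ u) ν := by
  rw [setLIntegral_congr_fun hW fun x hx => windowCrossings_succ_add_dirac hφ hc hν n c hx]
  simp only [windowCrossings_of_isTame hν]
  by_cases hn : ν ∈ {ν : Measure ℝ | ν W = n}
  · simp only [indicator_of_mem hn, ← crossingCount_add_const]
    rw [lintegral_iUnion (fun i => (hB i).measurableSet) hdis, tsum_fintype]
    exact lintegral_crossingCount_translate_le (hν.continuous_smear hφ hc) hB hmono hW hWB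
  · simp only [indicator_of_notMem hn, lintegral_zero, add_zero, le_refl]

namespace IsPoissonMeasure

variable {Ω : Type*} [MeasurableSpace Ω] {μ : Measure Ω} {r : ℝ≥0} {N : Ω → Measure ℝ}

-- Mecke's formula removes one of the `n + 1` points of the window, and averaging over its position
-- replaces its contribution to the path by a random constant.
theorem succ_mul_lintegral_windowCrossings_le [Fintype ι] [IsProbabilityMeasure μ]
    (hN : IsPoissonMeasure μ (r • volume) N) (hφ : HasQuadraticDecay φ) (hc : Continuous φ)
    (hB : ∀ i, (B i).OrdConnected) (hdis : Pairwise fun i j => Disjoint (B i) (B j))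
    (hmono : ∀ i, MonotoneOn φ (B i) ∨ AntitoneOn φ (B i)) (hW : MeasurableSet W)
    (hW' : volume W ≠ ∞) (hWB : ∀ x ∈ W, ∀ t ∈ Icc a b, t - x ∈ ⋃ i, B i) (n : ℕ) (c : ℝ) :
    ((n + 1 : ℕ) : ℝ≥0∞) * ∫⁻ ω, windowCrossings φ W a b (n + 1) c (N ω) ∂μ ≤
      r * (Fintype.card ι * ENNReal.ofReal (b - a) * μ {ω | N ω W = n} +
        ∫⁻ u in ⋃ i, B i, ∫⁻ ω, windowCrossings φ W a b n (c - φ u) (N ω) ∂μ) := by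
  have hmeas := measurable_windowCrossings (a := a) (b := b) hφ hc hW
  have hmeas' : Measurable (windowCrossings φ W a b (n + 1) c) :=
    (hmeas (n + 1)).comp (measurable_id.prodMk measurable_const)
  have hevent : MeasurableSet {ω | N ω W = n} :=
    hN.measurable_apply hW (measurableSet_singleton _)
  calc ((n + 1 : ℕ) : ℝ≥0∞) * ∫⁻ ω, windowCrossings φ W a b (n + 1) c (N ω) ∂μ
      = ∫⁻ ω, N ω W * windowCrossings φ W a b (n + 1) c (N ω) ∂μ := by
        refine (lintegral_const_mul _ (hmeas'.comp hN.measurable)).symm.trans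
          (lintegral_congr fun ω => ?_)
        by_cases hω : N ω ∈ {ν | IsTame ν ∧ ν W = (n + 1 : ℕ)}
        · rw [Function.comp_apply, hω.2]
        · simp only [windowCrossings, Function.comp_apply,
            indicator_of_notMem hω, mul_zero]
    _ = r * ∫⁻ x in W, ∫⁻ ω, windowCrossings φ W a b (n + 1) c (N ω + Measure.dirac x) ∂μ := by
        rw [hN.mecke_formula hW (ENNReal.mul_ne_top ENNReal.coe_ne_top hW') hmeas',
          Measure.restrict_smul, lintegral_smul_measure]
        rfl
    _ = r * ∫⁻ ω, (∫⁻ x in W, windowCrossings φ W a b (n + 1) c (N ω + Measure.dirac x)) ∂μ := by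
        exact congrArg _ (lintegral_lintegral_swap
          (hmeas'.comp hN.measurable_add_dirac).aemeasurable)
    _ ≤ r * ∫⁻ ω, ({ω | N ω W = n}.indicator
            (fun _ => Fintype.card ι * ENNReal.ofReal (b - a)) ω +
          ∫⁻ u in ⋃ i, B i, windowCrossings φ W a b n (c - φ u) (N ω)) ∂μ := by
        refine mul_le_mul_right (lintegral_mono_ae ?_) _
        filter_upwards [hN.ae_isTame] with ω hω
        exact lintegral_windowCrossings_add_dirac_le hφ hc hB hdis hmono hW hWB hω n c
    _ = _ := by
        rw [lintegral_add_left (measurable_const.indicator hevent),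
          lintegral_indicator_const hevent, lintegral_lintegral_swap]
        exact ((hmeas n).comp ((hN.measurable.comp measurable_fst).prodMk
          ((measurable_const.sub hc.measurable).comp measurable_snd))).aemeasurable

end IsPoissonMeasure

end

/-! ### The recursion over the number of points -/

-- The sequence `(K + 1) * exp (r * s) * Poisson (r * (w + s)) - K * Poisson (r * w)` satisfies the
-- recursion with equality.
theorem add_mul_poissonMeasure_le_of_recursion {m : ℕ → ℝ → ℝ≥0∞} {r w s : ℝ≥0} {K : ℝ≥0∞}
    {V : Set ℝ} {φ : ℝ → ℝ} (hV : volume V = (w + s : ℝ≥0))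
    (hbase : ∀ c, m 0 c ≤ poissonMeasure (r * w) {0})
    (hrec : ∀ (n : ℕ) c, ((n + 1 : ℕ) : ℝ≥0∞) * m (n + 1) c ≤
      r * (K * s * poissonMeasure (r * w) {n} + ∫⁻ u in V, m n (c - φ u))) (n : ℕ) (c : ℝ) :
    m n c + K * poissonMeasure (r * w) {n} ≤
      (K + 1) * (ENNReal.ofReal (Real.exp (r * s)) * poissonMeasure (r * (w + s)) {n}) := by
  set p : ℕ → ℝ≥0∞ := fun n => poissonMeasure (r * w) {n}
  set E : ℝ≥0∞ := ENNReal.ofReal (Real.exp (r * s))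
  set q : ℕ → ℝ≥0∞ := fun n => E * poissonMeasure (r * (w + s)) {n}
  have hp_succ : ∀ n : ℕ, ((n + 1 : ℕ) : ℝ≥0∞) * p (n + 1) = r * w * p n := fun n => by
    simpa only [ENNReal.coe_mul] using succ_mul_poissonMeasure_singleton (r * w) n
  have hq_succ : ∀ n : ℕ, ((n + 1 : ℕ) : ℝ≥0∞) * q (n + 1) = r * (w + s) * q n := fun n => by
    have h := succ_mul_poissonMeasure_singleton (r * (w + s)) n
    rw [ENNReal.coe_mul, ENNReal.coe_add] at h
    simp only [q]
    rw [mul_left_comm, h, mul_left_comm]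
  have hq_zero : q 0 = p 0 := by
    simpa only [q, E, mul_add, NNReal.coe_mul] using
      exp_mul_poissonMeasure_add_singleton_zero (r * w) (r * s)
  change m n c + K * p n ≤ (K + 1) * q n
  induction n generalizing c with
  | zero =>
    rw [hq_zero, add_comm (m 0 c), add_mul, one_mul]
    gcongr
    exact hbase c
  | succ n ih =>
    refine (ENNReal.mul_le_mul_iff_right (a := ((n + 1 : ℕ) : ℝ≥0∞)) (by simp)
      (ENNReal.natCast_ne_top _)).1 ?_
    calc ((n + 1 : ℕ) : ℝ≥0∞) * (m (n + 1) c + K * p (n + 1))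
        = ((n + 1 : ℕ) : ℝ≥0∞) * m (n + 1) c + K * (r * w * p n) := by
          rw [← hp_succ]
          ring
      _ ≤ r * (K * s * p n + ∫⁻ u in V, m n (c - φ u)) + K * (r * w * p n) :=
          add_le_add_left (hrec n c) _
      _ = r * ∫⁻ u in V, (m n (c - φ u) + K * p n) := by
          rw [lintegral_add_right _ measurable_const, setLIntegral_const, hV, ENNReal.coe_add]
          ring
      _ ≤ r * ∫⁻ _ in V, (K + 1) * q n := by
          gcongr with u
          exact ih _
      _ = ((n + 1 : ℕ) : ℝ≥0∞) * ((K + 1) * q (n + 1)) := by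
          rw [setLIntegral_const, hV, ENNReal.coe_add, mul_left_comm _ (K + 1), hq_succ]
          ring

namespace IsPoissonMeasure

variable {φ : ℝ → ℝ} {W : Set ℝ} {ι : Type*} {B : ι → Set ℝ} {a b : ℝ}
  {Ω : Type*} [MeasurableSpace Ω] {μ : Measure Ω} {r w : ℝ≥0}
  {N : Ω → Measure ℝ}

lemma measure_apply_eq_natCast_of_volume (hN : IsPoissonMeasure μ (r • volume) N)
    (hW : MeasurableSet W) (hw : volume W = w) (n : ℕ) :
    μ {ω | N ω W = n} = poissonMeasure (r * w) {n} := by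
  have hrate : (r • volume) W = (r * w : ℝ≥0) := by
    rw [Measure.smul_apply, hw]
    rfl
  rw [hN.measure_apply_eq_natCast hW (hrate ▸ ENNReal.coe_ne_top), hrate, ENNReal.toNNReal_coe]

lemma lintegral_crossingCount_eq_tsum [IsProbabilityMeasure μ]
    (hN : IsPoissonMeasure μ (r • volume) N)
    (hφ : HasQuadraticDecay φ) (hc : Continuous φ) (hW : MeasurableSet W) (hw : volume W = w)
    (c : ℝ) :
    ∫⁻ ω, (crossingCount (smear φ (N ω)) c a b : ℝ≥0∞) ∂μ =
      ∑' n, ∫⁻ ω, windowCrossings φ W a b n c (N ω) ∂μ := by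
  have hmeas : ∀ n, Measurable fun ω => windowCrossings φ W a b n c (N ω) := fun n =>
    (measurable_windowCrossings hφ hc hW n).comp (hN.measurable.prodMk measurable_const)
  rw [← lintegral_tsum fun n => (hmeas n).aemeasurable]
  refine lintegral_congr_ae ?_
  filter_upwards [hN.ae_isTame, hN.ae_exists_natCast hW
    (ENNReal.mul_ne_top ENNReal.coe_ne_top (hw ▸ ENNReal.coe_ne_top))] with ω hω ⟨k, hk⟩
  simp only [windowCrossings_of_isTame hω]
  rw [tsum_eq_single k fun n hn => indicator_of_notMem (fun h => hn ?_) _,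
    indicator_of_mem (s := {ν : Measure ℝ | ν W = k}) hk]
  exact Nat.cast_injective ((show N ω W = n from h).symm.trans hk)

theorem lintegral_crossingCount_add_card_le [Fintype ι] [IsProbabilityMeasure μ]
    (hN : IsPoissonMeasure μ (r • volume) N)
    (hφ : HasQuadraticDecay φ) (hc : Continuous φ)
    (hB : ∀ i, (B i).OrdConnected) (hdis : Pairwise fun i j => Disjoint (B i) (B j))
    (hmono : ∀ i, MonotoneOn φ (B i) ∨ AntitoneOn φ (B i)) (hW : MeasurableSet W)
    (hw : volume W = w) (hV : volume (⋃ i, B i) = (w + (b - a).toNNReal : ℝ≥0))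
    (hWB : ∀ x ∈ W, ∀ t ∈ Icc a b, t - x ∈ ⋃ i, B i)
    (hbase : ∀ c, ∫⁻ ω, windowCrossings φ W a b 0 c (N ω) ∂μ ≤ μ {ω | N ω W = 0}) (c : ℝ) :
    ∫⁻ ω, (crossingCount (smear φ (N ω)) c a b : ℝ≥0∞) ∂μ + Fintype.card ι ≤
      (Fintype.card ι + 1) * ENNReal.ofReal (Real.exp (r * (b - a).toNNReal)) := by
  have hp := hN.measure_apply_eq_natCast_of_volume hW hw
  calc ∫⁻ ω, (crossingCount (smear φ (N ω)) c a b : ℝ≥0∞) ∂μ + Fintype.card ι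
      = ∑' n, (∫⁻ ω, windowCrossings φ W a b n c (N ω) ∂μ +
          Fintype.card ι * poissonMeasure (r * w) {n}) := by
        rw [ENNReal.tsum_add, ENNReal.tsum_mul_left, tsum_poissonMeasure_singleton, mul_one,
          hN.lintegral_crossingCount_eq_tsum hφ hc hW hw]
    _ ≤ ∑' n, (Fintype.card ι + 1) * (ENNReal.ofReal (Real.exp (r * (b - a).toNNReal)) *
          poissonMeasure (r * (w + (b - a).toNNReal)) {n}) :=
        ENNReal.tsum_le_tsum fun n =>
          add_mul_poissonMeasure_le_of_recursion
            (m := fun n c => ∫⁻ ω, windowCrossings φ W a b n c (N ω) ∂μ) (φ := φ) hV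
            (fun c => (hbase c).trans_eq (by simpa using hp 0))
            (fun n c => hp n ▸ hN.succ_mul_lintegral_windowCrossings_le hφ hc hB hdis hmono hW
              (hw ▸ ENNReal.coe_ne_top) hWB n c) n c
    _ = _ := by
        rw [ENNReal.tsum_mul_left, ENNReal.tsum_mul_left, tsum_poissonMeasure_singleton, mul_one]

end IsPoissonMeasure

/-! ### Crossings by the derivative of the shot noise -/

section

variable {σ a b : ℝ}

lemma IsTame.crossingCount_smear_gaussianKernelDeriv_le_one (hσ : 0 < σ) {ν : Measure ℝ}
    (hν : IsTame ν) (hν0 : ν ≠ 0) (hνW : ν (Icc (a - σ) (b + σ)) = 0) (c : ℝ) :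
    crossingCount (smear (gaussianKernelDeriv σ) ν) c a b ≤ 1 := by
  have hmono : StrictMonoOn (smear (gaussianKernelDeriv σ) ν) (Icc a b) := by
    refine strictMonoOn_of_deriv_pos (convex_Icc a b)
      (hν.continuous_smear_gaussianKernelDeriv hσ).continuousOn fun t ht => ?_
    rw [hν.deriv_smear_gaussianKernelDeriv hσ]
    refine hν.smear_pos (hasQuadraticDecay_gaussianKernelDerivTwo hσ)
      (continuous_gaussianKernelDerivTwo σ) hν0 ?_
    filter_upwards [measure_eq_zero_iff_ae_notMem.1 hνW] with x hx
    rw [interior_Icc] at ht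
    rw [gaussianKernelDerivTwo_pos_iff hσ, lt_abs]
    rw [mem_Icc, not_and_or, not_le, not_le] at hx
    exact hx.imp (fun h => by linarith [ht.1]) fun h => by linarith [ht.2]
  exact encard_le_one_iff.2 fun t s ht hs => hmono.injOn ht.1 hs.1 (ht.2.trans hs.2.symm)

lemma iUnion_monotonicityInterval (σ : ℝ) : ⋃ i, monotonicityInterval σ i = univ := by
  refine eq_univ_of_forall fun u => mem_iUnion.2 ?_
  rcases lt_or_ge u (-σ) with h | h
  · exact ⟨0, h⟩
  · rcases le_or_gt u σ with h' | h'
    exacts [⟨1, h, h'⟩, ⟨2, h'⟩]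

lemma pairwise_disjoint_monotonicityInterval (hσ : 0 < σ) :
    Pairwise fun i j => Disjoint (monotonicityInterval σ i) (monotonicityInterval σ j) := by
  have h01 : Disjoint (Iio (-σ)) (Icc (-σ) σ) := disjoint_left.2 fun u h h' => h'.1.not_gt h
  have h02 : Disjoint (Iio (-σ)) (Ioi σ) :=
    disjoint_left.2 fun u (h : u < -σ) (h' : σ < u) => by linarith
  have h12 : Disjoint (Icc (-σ) σ) (Ioi σ) := disjoint_left.2 fun u h h' => h.2.not_gt h'
  intro i j hij
  fin_cases i <;> fin_cases j <;>
    first | exact absurd rfl hij | assumption | exact Disjoint.symm (by assumption)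

namespace IsPoissonMeasure

variable {Ω : Type*} [MeasurableSpace Ω] {μ : Measure Ω} {r : ℝ≥0} {N : Ω → Measure ℝ}

lemma lintegral_windowCrossings_zero_le (hσ : 0 < σ) (hN : IsPoissonMeasure μ (r • volume) N)
    (hN0 : ∀ᵐ ω ∂μ, N ω ≠ 0) (c : ℝ) :
    ∫⁻ ω, windowCrossings (gaussianKernelDeriv σ) (Icc (a - σ) (b + σ)) a b 0 c (N ω) ∂μ ≤
      μ {ω | N ω (Icc (a - σ) (b + σ)) = 0} := by
  have hvoid : MeasurableSet {ω | N ω (Icc (a - σ) (b + σ)) = 0} :=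
    hN.measurable_apply measurableSet_Icc (measurableSet_singleton 0)
  rw [← lintegral_indicator_one hvoid]
  refine lintegral_mono_ae ?_
  filter_upwards [hN0] with ω hω
  refine indicator_apply_le' (fun h => ?_) fun _ => zero_le
  have hzero : N ω (Icc (a - σ) (b + σ)) = 0 := by simpa using h.2
  rw [indicator_of_mem (by exact hzero), Pi.one_apply, ← ENat.toENNReal_one]
  exact ENat.toENNReal_le.2
    (h.1.crossingCount_smear_gaussianKernelDeriv_le_one hσ hω hzero c)

theorem lintegral_crossingCount_gaussianKernelDeriv_add_three_le [IsProbabilityMeasure μ]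
    (hσ : 0 < σ) (hN : IsPoissonMeasure μ (r • volume) N) (hN0 : ∀ᵐ ω ∂μ, N ω ≠ 0)
    (hab : a ≤ b) (c : ℝ) :
    ∫⁻ ω, (crossingCount (smear (gaussianKernelDeriv σ) (N ω)) c a b : ℝ≥0∞) ∂μ + 3 ≤
      4 * ENNReal.ofReal (Real.exp (r * (b - a))) := by
  set V : Set ℝ := Icc (a - b - σ) (b - a + σ)
  have hunion : ⋃ i, V ∩ monotonicityInterval σ i = V := by
    rw [← inter_iUnion, iUnion_monotonicityInterval σ, inter_univ]
  have hW : volume (Icc (a - σ) (b + σ)) = (b - a + 2 * σ).toNNReal := by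
    rw [Real.volume_Icc, ENNReal.ofReal]
    ring_nf
  have hV : volume V = ((b - a + 2 * σ).toNNReal + (b - a).toNNReal : ℝ≥0) := by
    rw [Real.volume_Icc, ENNReal.ofReal, ← Real.toNNReal_add (by linarith) (by linarith)]
    ring_nf
  have h := hN.lintegral_crossingCount_add_card_le (hasQuadraticDecay_gaussianKernelDeriv hσ)
    (continuous_gaussianKernelDeriv σ) (B := fun i => V ∩ monotonicityInterval σ i)
    (fun i => ordConnected_Icc.inter (ordConnected_monotonicityInterval σ i))
    (fun i j hij => (pairwise_disjoint_monotonicityInterval hσ hij).mono inter_subset_right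
      inter_subset_right)
    (fun i => (monotoneOn_or_antitoneOn_gaussianKernelDeriv hσ i).imp
      (fun h => h.mono inter_subset_right) fun h => h.mono inter_subset_right)
    measurableSet_Icc hW ((congrArg volume hunion).trans hV)
    (fun x hx t ht => hunion.symm.subset ⟨by linarith [hx.2, ht.1], by linarith [hx.1, ht.2]⟩)
    (hN.lintegral_windowCrossings_zero_le hσ hN0) c
  have hcard : (3 : ℝ≥0∞) + 1 = 4 := by norm_num
  rwa [Fintype.card_fin, Real.coe_toNNReal _ (sub_nonneg.2 hab), Nat.cast_ofNat, hcard] at h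

end IsPoissonMeasure

end

/-! ### Multiple zeros and fixed values -/

section

variable {σ a b : ℝ}

lemma countable_setOf_gaussianKernel_eq (hσ : 0 < σ) (c : ℝ) :
    {u | gaussianKernel σ u = c}.Countable := by
  rcases eq_empty_or_nonempty {u | gaussianKernel σ u = c} with h | ⟨v, rfl⟩
  · exact h ▸ countable_empty
  refine (toFinite {v, -v}).countable.mono fun u hu => sq_eq_sq_iff_eq_or_eq_neg.1 ?_
  have hexp := mul_left_cancel₀ (by positivity)
    (show gaussianKernel σ u = gaussianKernel σ v from hu)
  rw [Real.exp_eq_exp, div_left_inj' (by positivity)] at hexp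
  exact neg_injective hexp

namespace IsPoissonMeasure

variable {Ω : Type*} [MeasurableSpace Ω] {μ : Measure Ω} [IsProbabilityMeasure μ] {r : ℝ≥0}
  {N : Ω → Measure ℝ}

lemma aemeasurable_crossingCount_smear {φ : ℝ → ℝ} (hN : IsPoissonMeasure μ (r • volume) N)
    (hφ : HasQuadraticDecay φ) (hc : Continuous φ) (c a b : ℝ) :
    AEMeasurable (fun ν => crossingCount (smear φ ν) c a b) (μ.map N) := by
  have hind : Measurable ({ν | IsTame ν}.indicator fun ν => crossingCount (smear φ ν) c a b) := by
    rw [measurable_enat_iff]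
    convert measurable_indicator_crossingCount measurableSet_isTame
      (fun ν hν => IsTame.continuous_smear hν hφ hc) (measurable_smear hc.measurable) c a b
      using 2 with ν
    by_cases hν : IsTame ν <;> simp [hν]
  refine ⟨_, hind, ?_⟩
  filter_upwards [(ae_map_iff hN.measurable.aemeasurable measurableSet_isTame).2 hN.ae_isTame]
    with ν hν
  exact (indicator_of_mem (s := {ν | IsTame ν}) hν fun ν => crossingCount (smear φ ν) c a b).symm

lemma lintegral_crossingCount_gaussianKernelDeriv_ne_top (hσ : 0 < σ)
    (hN : IsPoissonMeasure μ (r • volume) N) (hN0 : ∀ᵐ ω ∂μ, N ω ≠ 0) (hab : a ≤ b) (c : ℝ) :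
    ∫⁻ ω, (crossingCount (smear (gaussianKernelDeriv σ) (N ω)) c a b : ℝ≥0∞) ∂μ ≠ ∞ :=
  ne_top_of_le_ne_top (ENNReal.mul_ne_top ENNReal.ofNat_ne_top ENNReal.ofReal_ne_top)
    (le_self_add.trans
      (hN.lintegral_crossingCount_gaussianKernelDeriv_add_three_le hσ hN0 hab c))

lemma ae_countable_level_smear_gaussianKernelDeriv (hσ : 0 < σ)
    (hN : IsPoissonMeasure μ (r • volume) N) (hN0 : ∀ᵐ ω ∂μ, N ω ≠ 0) (hab : a ≤ b) (c : ℝ) :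
    ∀ᵐ ω ∂μ, {t | t ∈ Icc a b ∧ smear (gaussianKernelDeriv σ) (N ω) t = c}.Countable := by
  have hmeas := (hN.aemeasurable_crossingCount_smear (hasQuadraticDecay_gaussianKernelDeriv hσ)
    (continuous_gaussianKernelDeriv σ) c a b).comp_measurable hN.measurable
  filter_upwards [ae_lt_top' (measurable_from_top.comp_aemeasurable hmeas)
    (hN.lintegral_crossingCount_gaussianKernelDeriv_ne_top hσ hN0 hab c)] with ω hω
  exact (encard_lt_top_iff.1 (ENat.toENNReal_lt_top.1 hω)).countable

theorem ae_not_exists_multiple_zero (hσ : 0 < σ) (hN : IsPoissonMeasure μ (r • volume) N)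
    (hN0 : ∀ᵐ ω ∂μ, N ω ≠ 0) (hab : a ≤ b) :
    ∀ᵐ ω ∂μ, ¬ ∃ t ∈ Icc a b, smear (gaussianKernelDeriv σ) (N ω) t = 0 ∧
      smear (gaussianKernelDerivTwo σ) (N ω) t = 0 := by
  set Z : Measure ℝ → ℝ → ℝ × ℝ := fun ν t =>
    (smear (gaussianKernelDeriv σ) ν t, smear (gaussianKernelDerivTwo σ) ν t)
  have hS : MeasurableSet {ν | IsTame ν ∧ ∃ t ∈ Icc a b, Z ν t = 0} :=
    measurableSet_exists_mem_eq_of_isCompact measurableSet_isTame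
      (fun ν (hν : IsTame ν) => (hν.continuous_smear_gaussianKernelDeriv hσ).prodMk
        (hν.continuous_smear_gaussianKernelDerivTwo hσ))
      (fun t => (measurable_smear (continuous_gaussianKernelDeriv σ).measurable t).prodMk
        (measurable_smear (continuous_gaussianKernelDerivTwo σ).measurable t)) isCompact_Icc 0
  have hcrit := countable_setOf_gaussianKernelDerivTwo_eq_zero hσ
  have hlevels : ∀ᵐ ω ∂μ, ∀ u ∈ {u | gaussianKernelDerivTwo σ u = 0},
      {t | t ∈ Icc a b ∧ smear (gaussianKernelDeriv σ) (N ω) t =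
        -gaussianKernelDeriv σ u}.Countable :=
    (ae_ball_iff hcrit).2 fun u _ =>
      hN.ae_countable_level_smear_gaussianKernelDeriv hσ hN0 hab _
  suffices h : ∀ᵐ ω ∂μ, N ω ∉ {ν | IsTame ν ∧ ∃ t ∈ Icc a b, Z ν t = 0} by
    filter_upwards [hN.ae_isTame, h] with ω hω h ⟨t, ht, h0, h0'⟩
    exact h ⟨hω, t, ht, Prod.ext h0 h0'⟩
  refine hN.ae_notMem_of_add_dirac hN0 hS ?_
  filter_upwards [hN.ae_isTame, hlevels] with ω hω hω'
  refine Measure.ae_smul_measure ?_ r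
  filter_upwards [measure_eq_zero_iff_ae_notMem.1 (volume_exists_tangent_eq_zero
    (hω.hasDerivAt_smear_gaussianKernelDeriv hσ) (hasStrictDerivAt_gaussianKernelDeriv σ)
    hcrit hω')] with x hx
  rintro ⟨-, t, ht, h0⟩
  refine hx ⟨t, ht, ?_, ?_⟩
  · rw [← hω.smear_add_dirac (hasQuadraticDecay_gaussianKernelDeriv hσ)
      (continuous_gaussianKernelDeriv σ)]
    exact congrArg Prod.fst h0
  · rw [← hω.smear_add_dirac (hasQuadraticDecay_gaussianKernelDerivTwo hσ)
      (continuous_gaussianKernelDerivTwo σ)]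
    exact congrArg Prod.snd h0

lemma ae_smear_gaussianKernel_ne (hσ : 0 < σ) (hN : IsPoissonMeasure μ (r • volume) N)
    (hN0 : ∀ᵐ ω ∂μ, N ω ≠ 0) (c t : ℝ) :
    ∀ᵐ ω ∂μ, smear (gaussianKernel σ) (N ω) t ≠ c := by
  refine hN.ae_notMem_of_add_dirac hN0 (S := {ν | smear (gaussianKernel σ) ν t = c})
    (measurable_smear (continuous_gaussianKernel σ).measurable t (measurableSet_singleton c)) ?_
  filter_upwards [hN.ae_isTame] with ω hω
  refine Measure.ae_smul_measure ?_ r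
  filter_upwards [((countable_setOf_gaussianKernel_eq hσ
    (c - smear (gaussianKernel σ) (N ω) t)).image (t - ·)).ae_notMem volume] with x hx h
  refine hx ⟨t - x, ?_, sub_sub_cancel t x⟩
  exact eq_sub_of_add_eq' ((hω.smear_add_dirac (hasQuadraticDecay_gaussianKernel hσ)
    (continuous_gaussianKernel σ) x t).symm.trans h)

end IsPoissonMeasure

end

/-! ### Comparison of the crossings of a path and of its derivative -/

lemma le_of_forall_nat_mul_le_nat_mul_add_one {x y : ℝ≥0∞}
    (h : ∀ n : ℕ, 1 ≤ n → n * x ≤ n * y + 1) : x ≤ y := by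
  have hlim : Filter.Tendsto (fun n : ℕ => y + (n : ℝ≥0∞)⁻¹) Filter.atTop (nhds (y + 0)) :=
    tendsto_const_nhds.add ENNReal.tendsto_inv_nat_nhds_zero
  rw [add_zero] at hlim
  refine ge_of_tendsto hlim ?_
  filter_upwards [Filter.eventually_ge_atTop 1] with n hn
  have hn0 : (n : ℝ≥0∞) ≠ 0 := Nat.cast_ne_zero.2 (Nat.one_le_iff_ne_zero.1 hn)
  rw [← ENNReal.mul_le_mul_iff_right hn0 (ENNReal.natCast_ne_top n), mul_add,
    ENNReal.mul_inv_cancel hn0 (ENNReal.natCast_ne_top n)]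
  exact h n hn

namespace IsPoissonMeasure

variable {Ω : Type*} [MeasurableSpace Ω] {μ : Measure Ω} [IsProbabilityMeasure μ] {r : ℝ≥0}
  {N : Ω → Measure ℝ} {φ : ℝ → ℝ} {σ : ℝ}

lemma lintegral_crossingCount_smear_add (hN : IsPoissonMeasure μ (r • volume) N)
    (hφ : HasQuadraticDecay φ) (hc : Continuous φ) (c a b s : ℝ) :
    ∫⁻ ω, (crossingCount (smear φ (N ω)) c (a + s) (b + s) : ℝ≥0∞) ∂μ =
      ∫⁻ ω, (crossingCount (smear φ (N ω)) c a b : ℝ≥0∞) ∂μ := by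
  have hF : AEMeasurable (fun ν => (crossingCount (smear φ ν) c a b : ℝ≥0∞)) (μ.map N) :=
    measurable_from_top.comp_aemeasurable (hN.aemeasurable_crossingCount_smear hφ hc c a b)
  have hshift : Measurable fun ω => (N ω).map (· - s) :=
    (Measure.measurable_map _ (by fun_prop)).comp hN.measurable
  calc ∫⁻ ω, (crossingCount (smear φ (N ω)) c (a + s) (b + s) : ℝ≥0∞) ∂μ
      = ∫⁻ ω, (crossingCount (smear φ ((N ω).map (· - s))) c a b : ℝ≥0∞) ∂μ := by
        refine lintegral_congr fun ω => ?_
        rw [← crossingCount_comp_add, funext (smear_map_sub hc.measurable (N ω) s)]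
    _ = ∫⁻ ν, (crossingCount (smear φ ν) c a b : ℝ≥0∞) ∂μ.map N := by
        rw [← hN.map_translate_eq s] at hF ⊢
        exact (lintegral_map' hF hshift.aemeasurable).symm
    _ = ∫⁻ ω, (crossingCount (smear φ (N ω)) c a b : ℝ≥0∞) ∂μ :=
        lintegral_map' hF hN.measurable.aemeasurable

lemma lintegral_sum_crossingCount_smear (hN : IsPoissonMeasure μ (r • volume) N)
    (hφ : HasQuadraticDecay φ) (hc : Continuous φ) (c : ℝ) (n : ℕ) :
    ∫⁻ ω, ((∑ k ∈ Finset.range n, crossingCount (smear φ (N ω)) c k (k + 1) : ℕ∞) : ℝ≥0∞) ∂μ =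
      n * ∫⁻ ω, (crossingCount (smear φ (N ω)) c 0 1 : ℝ≥0∞) ∂μ := by
  have hmeas : ∀ k : ℕ, AEMeasurable
      (fun ω => (crossingCount (smear φ (N ω)) c k (k + 1) : ℝ≥0∞)) μ := fun k =>
    measurable_from_top.comp_aemeasurable
      ((hN.aemeasurable_crossingCount_smear hφ hc c k (k + 1)).comp_measurable hN.measurable)
  have hstat : ∀ k : ℕ, ∫⁻ ω, (crossingCount (smear φ (N ω)) c k (k + 1) : ℝ≥0∞) ∂μ =
      ∫⁻ ω, (crossingCount (smear φ (N ω)) c 0 1 : ℝ≥0∞) ∂μ := fun k => by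
    rw [← hN.lintegral_crossingCount_smear_add hφ hc c 0 1 k, zero_add, add_comm 1]
  simp only [← ENat.toENNRealRingHom_apply, map_sum]
  simp only [ENat.toENNRealRingHom_apply]
  rw [lintegral_finsetSum' _ fun k _ => hmeas k]
  simp only [hstat, Finset.sum_const, Finset.card_range, nsmul_eq_mul]

theorem lintegral_crossingCount_gaussianKernel_le (hσ : 0 < σ)
    (hN : IsPoissonMeasure μ (r • volume) N) (hN0 : ∀ᵐ ω ∂μ, N ω ≠ 0) (c : ℝ) :
    ∫⁻ ω, (crossingCount (smear (gaussianKernel σ) (N ω)) c 0 1 : ℝ≥0∞) ∂μ ≤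
      ∫⁻ ω, (crossingCount (smear (gaussianKernelDeriv σ) (N ω)) 0 0 1 : ℝ≥0∞) ∂μ := by
  refine le_of_forall_nat_mul_le_nat_mul_add_one fun n hn => ?_
  rw [← hN.lintegral_sum_crossingCount_smear (hasQuadraticDecay_gaussianKernel hσ)
      (continuous_gaussianKernel σ),
    ← hN.lintegral_sum_crossingCount_smear (hasQuadraticDecay_gaussianKernelDeriv hσ)
      (continuous_gaussianKernelDeriv σ), ← measure_univ (μ := μ), ← lintegral_one,
    ← lintegral_add_right _ measurable_const]
  have hne : ∀ᵐ ω ∂μ, ∀ k : ℕ, smear (gaussianKernel σ) (N ω) k ≠ c :=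
    ae_all_iff.2 fun k => hN.ae_smear_gaussianKernel_ne hσ hN0 c k
  refine lintegral_mono_ae ?_
  filter_upwards [hN.ae_isTame, hne] with ω hω hω'
  rw [← ENat.toENNReal_one, ← ENat.toENNReal_add]
  exact ENat.toENNReal_le.2 (sum_crossingCount_le_sum_crossingCount_deriv_add_one
    (hω.hasDerivAt_smear_gaussianKernel hσ) hω' hn)

end IsPoissonMeasure

/-! ### The shot noise process -/

lemma le_ofReal_of_add_three_le {lam σ : ℝ} (hlam : 0 ≤ lam) (hσ : 0 ≤ σ) {x : ℝ≥0∞}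
    (h : x + 3 ≤ 4 * ENNReal.ofReal (Real.exp lam)) :
    x ≤ ENNReal.ofReal ((3 * lam * (2 + 2 * σ) + 1) * Real.exp lam) := by
  have hexp : (1 - lam) * Real.exp lam ≤ 1 := by
    simpa only [← Real.exp_add, neg_add_cancel, Real.exp_zero] using
      mul_le_mul_of_nonneg_right (Real.one_sub_le_exp_neg lam) (Real.exp_nonneg lam)
  have hreal : 4 * Real.exp lam ≤ (3 * lam * (2 + 2 * σ) + 1) * Real.exp lam + 3 := by
    have : 0 ≤ lam * Real.exp lam := by positivity
    have : 0 ≤ lam * σ * Real.exp lam := by positivity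
    linarith
  refine (ENNReal.add_le_add_iff_right (a := 3) ENNReal.ofNat_ne_top).1 (h.trans ?_)
  calc 4 * ENNReal.ofReal (Real.exp lam) = ENNReal.ofReal (4 * Real.exp lam) := by
        rw [ENNReal.ofReal_mul zero_le_four, ENNReal.ofReal_ofNat]
    _ ≤ ENNReal.ofReal ((3 * lam * (2 + 2 * σ) + 1) * Real.exp lam + 3) :=
        ENNReal.ofReal_le_ofReal hreal
    _ = ENNReal.ofReal ((3 * lam * (2 + 2 * σ) + 1) * Real.exp lam) + 3 := by
        rw [ENNReal.ofReal_add (by positivity) zero_le_three, ENNReal.ofReal_ofNat]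

lemma localExtrCount_eq_crossingCount_deriv {f : ℝ → ℝ} {a b : ℝ}
    (h : ∀ t ∈ Icc a b, IsLocalExtr f t ↔ deriv f t = 0) :
    localExtrCount f a b = crossingCount (deriv f) 0 a b :=
  congrArg encard (ext fun t => and_congr_right (h t))

namespace IsPoissonProcess

variable {Ω : Type*} [MeasurableSpace Ω] {μ : Measure Ω} {lam σ a b : ℝ} {τ : ℕ → Ω → ℝ}

lemma ae_pointMeasure_ne_zero (hlam : 0 < lam) (hτ : IsPoissonProcess μ lam τ) :
    ∀ᵐ ω ∂μ, pointMeasure τ ω ≠ 0 := by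
  refine (hτ.isPoissonMeasure hlam).ae_ne_zero ?_
  rw [Measure.smul_apply, Real.volume_univ]
  exact ENNReal.mul_top (ENNReal.coe_ne_zero.2 (Real.toNNReal_pos.2 hlam).ne')

variable [IsProbabilityMeasure μ]

lemma ae_shotNoise_eq (hlam : 0 < lam) (hσ : 0 < σ) (hτ : IsPoissonProcess μ lam τ) :
    ∀ᵐ ω ∂μ, shotNoise σ τ ω = smear (gaussianKernel σ) (pointMeasure τ ω) := by
  filter_upwards [(hτ.isPoissonMeasure hlam).ae_isTame] with ω hω using shotNoise_eq_smear hσ hω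

lemma ae_deriv_shotNoise_eq (hlam : 0 < lam) (hσ : 0 < σ) (hτ : IsPoissonProcess μ lam τ) :
    ∀ᵐ ω ∂μ, deriv (shotNoise σ τ ω) = smear (gaussianKernelDeriv σ) (pointMeasure τ ω) := by
  filter_upwards [(hτ.isPoissonMeasure hlam).ae_isTame] with ω hω
  rw [shotNoise_eq_smear hσ hω, hω.deriv_smear_gaussianKernel hσ]

lemma ae_summable_and_contDiff (hlam : 0 < lam) (hσ : 0 < σ) (hτ : IsPoissonProcess μ lam τ) :
    ∀ᵐ ω ∂μ, (∀ t, Summable fun i => gaussianKernel σ (t - τ i ω)) ∧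
      ContDiff ℝ 2 (shotNoise σ τ ω) := by
  filter_upwards [(hτ.isPoissonMeasure hlam).ae_isTame] with ω hω
  exact ⟨summable_gaussianKernel hσ hω,
    shotNoise_eq_smear hσ hω ▸ hω.contDiff_smear_gaussianKernel hσ⟩

lemma aemeasurable_crossingCount_shotNoise (hlam : 0 < lam) (hσ : 0 < σ)
    (hτ : IsPoissonProcess μ lam τ) (c a b : ℝ) :
    AEMeasurable (fun ω => crossingCount (shotNoise σ τ ω) c a b) μ := by
  have hN := hτ.isPoissonMeasure hlam
  refine ((hN.aemeasurable_crossingCount_smear (hasQuadraticDecay_gaussianKernel hσ)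
    (continuous_gaussianKernel σ) c a b).comp_measurable hN.measurable).congr ?_
  filter_upwards [hτ.ae_shotNoise_eq hlam hσ] with ω hω
  rw [hω, Function.comp_apply]

lemma aemeasurable_crossingCount_deriv_shotNoise (hlam : 0 < lam) (hσ : 0 < σ)
    (hτ : IsPoissonProcess μ lam τ) (c a b : ℝ) :
    AEMeasurable (fun ω => crossingCount (deriv (shotNoise σ τ ω)) c a b) μ := by
  have hN := hτ.isPoissonMeasure hlam
  refine ((hN.aemeasurable_crossingCount_smear (hasQuadraticDecay_gaussianKernelDeriv hσ)
    (continuous_gaussianKernelDeriv σ) c a b).comp_measurable hN.measurable).congr ?_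
  filter_upwards [hτ.ae_deriv_shotNoise_eq hlam hσ] with ω hω
  rw [hω, Function.comp_apply]

theorem ae_not_exists_multiple_zero_deriv (hlam : 0 < lam) (hσ : 0 < σ)
    (hτ : IsPoissonProcess μ lam τ) (hab : a ≤ b) :
    ∀ᵐ ω ∂μ, ¬ ∃ t ∈ Icc a b, deriv (shotNoise σ τ ω) t = 0 ∧
      deriv (deriv (shotNoise σ τ ω)) t = 0 := by
  have hN := hτ.isPoissonMeasure hlam
  filter_upwards [hN.ae_isTame, hτ.ae_deriv_shotNoise_eq hlam hσ,
    hN.ae_not_exists_multiple_zero hσ (hτ.ae_pointMeasure_ne_zero hlam) hab] with ω hω hderiv h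
  rwa [hderiv, hω.deriv_smear_gaussianKernelDeriv hσ]

lemma ae_isLocalExtr_iff (hlam : 0 < lam) (hσ : 0 < σ) (hτ : IsPoissonProcess μ lam τ)
    (hab : a ≤ b) :
    ∀ᵐ ω ∂μ, ∀ t ∈ Icc a b, IsLocalExtr (shotNoise σ τ ω) t ↔ deriv (shotNoise σ τ ω) t = 0 := by
  filter_upwards [hτ.ae_summable_and_contDiff hlam hσ,
    hτ.ae_not_exists_multiple_zero_deriv hlam hσ hab] with ω hω h t ht
  exact isLocalExtr_iff_deriv_eq_zero hω.2.continuous.continuousAt fun h0 => h ⟨t, ht, h0⟩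

lemma ae_localExtrCount_eq (hlam : 0 < lam) (hσ : 0 < σ) (hτ : IsPoissonProcess μ lam τ)
    (hab : a ≤ b) :
    ∀ᵐ ω ∂μ, localExtrCount (shotNoise σ τ ω) a b =
      crossingCount (deriv (shotNoise σ τ ω)) 0 a b := by
  filter_upwards [hτ.ae_isLocalExtr_iff hlam hσ hab] with ω hω
  exact localExtrCount_eq_crossingCount_deriv hω

lemma meanLocalExtr_eq (hlam : 0 < lam) (hσ : 0 < σ) (hτ : IsPoissonProcess μ lam τ)
    (hab : a ≤ b) :
    meanLocalExtr μ (shotNoise σ τ) a b =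
      meanCrossings μ (fun ω => deriv (shotNoise σ τ ω)) 0 a b := by
  refine lintegral_congr_ae ?_
  filter_upwards [hτ.ae_localExtrCount_eq hlam hσ hab] with ω hω
  rw [hω]

lemma meanCrossings_deriv_eq (hlam : 0 < lam) (hσ : 0 < σ) (hτ : IsPoissonProcess μ lam τ)
    (c a b : ℝ) :
    meanCrossings μ (fun ω => deriv (shotNoise σ τ ω)) c a b =
      ∫⁻ ω, (crossingCount (smear (gaussianKernelDeriv σ) (pointMeasure τ ω)) c a b : ℝ≥0∞) ∂μ := by
  refine lintegral_congr_ae ?_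
  filter_upwards [hτ.ae_deriv_shotNoise_eq hlam hσ] with ω hω
  rw [hω]

theorem meanCrossings_le_meanCrossings_deriv (hlam : 0 < lam) (hσ : 0 < σ)
    (hτ : IsPoissonProcess μ lam τ) (c : ℝ) :
    meanCrossings μ (shotNoise σ τ) c 0 1 ≤
      meanCrossings μ (fun ω => deriv (shotNoise σ τ ω)) 0 0 1 := by
  rw [hτ.meanCrossings_deriv_eq hlam hσ]
  refine le_of_eq_of_le (lintegral_congr_ae ?_) ((hτ.isPoissonMeasure
    hlam).lintegral_crossingCount_gaussianKernel_le hσ (hτ.ae_pointMeasure_ne_zero hlam) c)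
  filter_upwards [hτ.ae_shotNoise_eq hlam hσ] with ω hω
  rw [hω]

theorem meanCrossings_deriv_add_three_le (hlam : 0 < lam) (hσ : 0 < σ)
    (hτ : IsPoissonProcess μ lam τ) (hab : a ≤ b) (c : ℝ) :
    meanCrossings μ (fun ω => deriv (shotNoise σ τ ω)) c a b + 3 ≤
      4 * ENNReal.ofReal (Real.exp (lam * (b - a))) := by
  have h := (hτ.isPoissonMeasure hlam).lintegral_crossingCount_gaussianKernelDeriv_add_three_le hσ
    (hτ.ae_pointMeasure_ne_zero hlam) hab c
  rwa [Real.coe_toNNReal lam hlam.le, ← hτ.meanCrossings_deriv_eq hlam hσ] at h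

end IsPoissonProcess

end ShotNoise

end

theorem proposition9 {Ω : Type*} [MeasurableSpace Ω] (μ : Measure Ω) [IsProbabilityMeasure μ]
    (lam σ : ℝ) (hlam : 0 < lam) (hσ : 0 < σ) (τ : ℕ → Ω → ℝ)
    (hτ : ShotNoise.IsPoissonProcess μ lam τ) :
    -- the series converges and defines a twice continuously differentiable path, almost surely
    (∀ᵐ ω ∂μ, (∀ t : ℝ, Summable fun i => ShotNoise.gaussianKernel σ (t - τ i ω)) ∧
      ContDiff ℝ 2 (ShotNoise.shotNoise σ τ ω)) ∧
    -- the counting variables are random variables, up to null sets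
    (∀ α : ℝ, AEMeasurable
      (fun ω => ShotNoise.crossingCount (ShotNoise.shotNoise σ τ ω) α 0 1) μ) ∧
    AEMeasurable
      (fun ω => ShotNoise.crossingCount (deriv (ShotNoise.shotNoise σ τ ω)) 0 0 1) μ ∧
    AEMeasurable (fun ω => ShotNoise.localExtrCount (ShotNoise.shotNoise σ τ ω) 0 1) μ ∧
    -- the first two derivatives have almost surely no common zero in `[0, 1]`
    μ {ω | ∃ t ∈ Icc (0 : ℝ) 1, deriv (ShotNoise.shotNoise σ τ ω) t = 0 ∧
      deriv (deriv (ShotNoise.shotNoise σ τ ω)) t = 0} = 0 ∧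
    -- the local extrema in `[0, 1]` are almost surely exactly the zeros of the derivative
    (∀ᵐ ω ∂μ, ∀ t ∈ Icc (0 : ℝ) 1, IsLocalExtr (ShotNoise.shotNoise σ τ ω) t ↔
      deriv (ShotNoise.shotNoise σ τ ω) t = 0) ∧
    ShotNoise.meanLocalExtr μ (ShotNoise.shotNoise σ τ) 0 1 =
      ShotNoise.meanCrossings μ (fun ω => deriv (ShotNoise.shotNoise σ τ ω)) 0 0 1 ∧
    (∀ α : ℝ, ShotNoise.meanCrossings μ (ShotNoise.shotNoise σ τ) α 0 1 ≤
      ShotNoise.meanLocalExtr μ (ShotNoise.shotNoise σ τ) 0 1) ∧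
    ShotNoise.meanLocalExtr μ (ShotNoise.shotNoise σ τ) 0 1 ≤
      ENNReal.ofReal ((3 * lam * (2 + 2 * σ) + 1) * Real.exp lam) := by
  have hmeas := hτ.aemeasurable_crossingCount_deriv_shotNoise hlam hσ 0 0 1
  have hcount := hτ.ae_localExtrCount_eq hlam hσ zero_le_one
  have hmean := hτ.meanLocalExtr_eq hlam hσ zero_le_one
  have hbound := hτ.meanCrossings_deriv_add_three_le hlam hσ zero_le_one 0
  rw [sub_zero, mul_one, ← hmean] at hbound
  exact ⟨hτ.ae_summable_and_contDiff hlam hσ,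
    fun α => hτ.aemeasurable_crossingCount_shotNoise hlam hσ α 0 1,
    hmeas,
    hmeas.congr (hcount.mono fun _ => Eq.symm),
    measure_eq_zero_iff_ae_notMem.2 (hτ.ae_not_exists_multiple_zero_deriv hlam hσ zero_le_one),
    hτ.ae_isLocalExtr_iff hlam hσ zero_le_one,
    hmean,
    fun α => (hτ.meanCrossings_le_meanCrossings_deriv hlam hσ α).trans_eq hmean.symm,
    ShotNoise.le_ofReal_of_add_three_le hlam.le hσ.le hbound⟩
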